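/- Let $N\ge 1$ and let $\mathbf M^{N\times N}$ be the space of real $N\times N$ matrices. For $\mathbf F\in\mathbf M^{N\times N}$ let $\operatorname{adj}\mathbf F$ denote the matrix of cofactors of $\mathbf F$ (so that $\mathbf F\,(\operatorname{adj}\mathbf F)^T=\det(\mathbf F)\,\mathbf 1$). Fix $j\in\{1,\dots,N\}$ and let $\mathbf F^{(j)}$ be the $j$-th row of $\mathbf F$ and $\operatorname{adj}^{(j)}\mathbf F$ the $j$-th row of $\operatorname{adj}\mathbf F$; or, alternatively, let both be the $j$-th columns. Let $|\cdot|$ be the Euclidean norm of vectors and put $$\mathbf M_j=\{\mathbf F\in\mathbf M^{N\times N}:\ \alpha\,\mathbf F^{(j)}=\operatorname{adj}^{(j)}\mathbf F\ \text{ for some }\alpha\in\mathbb R\}.$$ Let $\Omega\subset\mathbb R^N$ be a nonempty bounded open set. A Borel probability measure $\nu$ on $\mathbf M^{N\times N}$ is a homogeneous gradient Young measure if there are uniformly bounded and uniformly Lipschitz maps $\mathbf u_k:\Omega\to\mathbb R^N$ such that, for every continuous $\psi:\mathbf M^{N\times N}\to\mathbb R$, the functions $\psi(\nabla\mathbf u_k)$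 converge weakly-$*$ in $L^\infty(\Omega)$ to the constant $\int\psi\,d\nu$. For $\phi:\mathbf M^{N\times N}\to\mathbb R\cup\{+\infty\}$ the quasiconvexification is $$Q\phi(\mathbf F)=\inf\Big\{\int\phi\,d\nu:\ \nu\text{ a homogeneous gradient Young measure with barycenter }\int \mathbf A\,d\nu(\mathbf A)=\mathbf F\Big\}.$$ **Theorem.** Let $\phi:\mathbf M^{N\times N}\to\mathbb R\cup\{+\infty\}$ be any function such that $$\phi(\mathbf F)=|\det\mathbf F|\ \text{ for }\mathbf F\in\mathbf M_j,\qquad \phi(\mathbf F)\ge|\det\mathbf F|\ \text{ for }\mathbf F\notin\mathbf M_j .$$ Then $Q\phi(\mathbf F)=|\det\mathbf F|$ for every $\mathbf F\in\mathbf M^{N\times N}$. If, moreover, $\phi$ is bounded on bounded sets, then also the classical formula for the quasiconvexification gives $$\inf_{\mathbf u\in W^{1,\infty}_0(\Omega,\mathbb R^N)}\frac1{|\Omega|}\int_\Omega\phi(\mathbf F+\nabla\mathbf u(\mathbf y))\,d\mathbf y=|\det\mathbf F|\qquad\text{for every }\mathbf F,$$ where $W^{1,\infty}_0(\Omega,\mathbb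 R^N)$ stands for the Lipschitz maps $\mathbf u:\mathbb R^N\to\mathbb R^N$ that vanish outside $\Omega$. In particular, for $\phi(\mathbf F)=|\operatorname{adj}^{(j)}\mathbf F|\,|\mathbf F^{(j)}|$ we have $Q\phi(\mathbf F)=|\det\mathbf F|$ for every $\mathbf F$, and the classical formula gives the same value. (Integrals of non-negative functions take values in $[0,+\infty]$; for a non-measurable $\phi$ they are understood as lower integrals.) -/

import Mathlib

open MeasureTheory Filter Topology

noncomputable section

/-- Matrices carry the Borel σ-algebra (the product σ-algebra of the entries). -/
instance matrixMeasurableSpace {m N : ℕ} : MeasurableSpace (Matrix (Fin m) (Fin N) ℝ) :=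
  inferInstanceAs (MeasurableSpace (Fin m → Fin N → ℝ))

instance matrixBorelSpace {m N : ℕ} : BorelSpace (Matrix (Fin m) (Fin N) ℝ) :=
  inferInstanceAs (BorelSpace (Fin m → Fin N → ℝ))

/-- The gradient of `u : ℝᴺ → ℝᵐ` at `x` as an `m × N` matrix, with entries `∂uᵢ/∂xⱼ`.
For a Lipschitz map it is the true gradient at almost every point, by Rademacher's theorem. -/
def gradMatrix {m N : ℕ} (u : EuclideanSpace ℝ (Fin N) → EuclideanSpace ℝ (Fin m))
    (x : EuclideanSpace ℝ (Fin N)) : Matrix (Fin m) (Fin N) ℝ :=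
  Matrix.of fun i j => fderiv ℝ u x (EuclideanSpace.single j 1) i

/-- `ν` is a homogeneous gradient Young measure over `Ω ⊆ ℝᴺ`: a Borel probability measure on
`m × N` matrices generated by the gradients of a sequence of uniformly bounded, uniformly Lipschitz
maps `u k : Ω → ℝᵐ`, that is, for every continuous `ψ` the functions `ψ (∇ u k)` converge weakly-*
in `L^∞(Ω)` to the constant `∫ ψ dν`. -/
def IsHomogeneousGradientYoungMeasure {m N : ℕ} (Ω : Set (EuclideanSpace ℝ (Fin N)))
    (ν : Measure (Matrix (Fin m) (Fin N) ℝ)) : Prop :=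
  IsProbabilityMeasure ν ∧
    ∃ (u : ℕ → EuclideanSpace ℝ (Fin N) → EuclideanSpace ℝ (Fin m)) (K : NNReal) (C : ℝ),
      (∀ k, LipschitzOnWith K (u k) Ω) ∧
      (∀ k, ∀ x ∈ Ω, ‖u k x‖ ≤ C) ∧
      ∀ ψ : Matrix (Fin m) (Fin N) ℝ → ℝ, Continuous ψ →
        ∀ g : EuclideanSpace ℝ (Fin N) → ℝ, IntegrableOn g Ω volume →
          Tendsto (fun k => ∫ x in Ω, g x * ψ (gradMatrix (u k) x)) atTop
            (𝓝 ((∫ x in Ω, g x) * ∫ A, ψ A ∂ν))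

/-- The barycenter (first moment) of a measure on matrices, taken entrywise. -/
def matrixBarycenter {m N : ℕ} (ν : Measure (Matrix (Fin m) (Fin N) ℝ)) :
    Matrix (Fin m) (Fin N) ℝ :=
  Matrix.of fun i j => ∫ A, A i j ∂ν

/-- The integral `∫ f dμ ∈ [-∞, +∞]` of an extended-real-valued function, as the integral of the
positive part minus the integral of the negative part. (For `f ≥ 0` it is the Lebesgue integral
with value in `[0, +∞]`.) -/
def extIntegral {X : Type*} [MeasurableSpace X] (μ : Measure X) (f : X → EReal) : EReal :=
  ((∫⁻ x, (f x).toENNReal ∂μ : ENNReal) : EReal) -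
    ((∫⁻ x, (-f x).toENNReal ∂μ : ENNReal) : EReal)

/-- The quasiconvexification `Qφ` of an integrand `φ` with values in `ℝ ∪ {+∞}`:
`Qφ(F)` is the infimum of `⟨φ, ν⟩` over all homogeneous gradient Young measures `ν` with
barycenter `F`. -/
def quasiconvexification {m N : ℕ} (Ω : Set (EuclideanSpace ℝ (Fin N)))
    (φ : Matrix (Fin m) (Fin N) ℝ → EReal) (F : Matrix (Fin m) (Fin N) ℝ) : EReal :=
  sInf {e : EReal | ∃ ν : Measure (Matrix (Fin m) (Fin N) ℝ),
    IsHomogeneousGradientYoungMeasure Ω ν ∧ matrixBarycenter ν = F ∧ e = extIntegral ν φ}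

/-- The classical formula for the quasiconvexification (of a real-valued integrand): the infimum,
over Lipschitz maps `u : ℝᴺ → ℝᵐ` vanishing off `D`, of the average over `D` of `φ (F + ∇u)`. -/
def dirichletQuasiconvexification {m N : ℕ} (D : Set (EuclideanSpace ℝ (Fin N)))
    (φ : Matrix (Fin m) (Fin N) ℝ → EReal) (F : Matrix (Fin m) (Fin N) ℝ) : EReal :=
  sInf {e : EReal | ∃ u : EuclideanSpace ℝ (Fin N) → EuclideanSpace ℝ (Fin m),
    (∃ K : NNReal, LipschitzWith K u) ∧ (∀ x, x ∉ D → u x = 0) ∧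
    e = extIntegral ((volume D)⁻¹ • volume.restrict D) fun x => φ (F + gradMatrix u x)}

/-- The `2N` lines of an `N × N` matrix, as Euclidean vectors: `Sum.inl j` stands for the `j`-th
row and `Sum.inr j` for the `j`-th column. -/
def matrixLine {N : ℕ} (j : Fin N ⊕ Fin N) (A : Matrix (Fin N) (Fin N) ℝ) :
    EuclideanSpace ℝ (Fin N) :=
  Sum.elim (fun r => WithLp.toLp 2 (A.row r)) (fun c => WithLp.toLp 2 (A.col c)) j

/-- The row or column of the matrix of cofactors of `F` that matches the line `j` of `F`. The
matrix of cofactors is the transpose of Mathlib's `adjugate`, so that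
`det F = ⟪adjLine j F, matrixLine j F⟫` for each of the `2N` lines. -/
def adjLine {N : ℕ} (j : Fin N ⊕ Fin N) (F : Matrix (Fin N) (Fin N) ℝ) :
    EuclideanSpace ℝ (Fin N) :=
  matrixLine j F.adjugate.transpose

/-- The set of matrices whose line `j` satisfies `α F⁽ʲ⁾ = adj⁽ʲ⁾ F` for some real `α`. -/
def coincidenceSet {N : ℕ} (j : Fin N ⊕ Fin N) : Set (Matrix (Fin N) (Fin N) ℝ) :=
  {F | ∃ α : ℝ, α • matrixLine j F = adjLine j F}

end

/-! Both infima are squeezed between a lower bound, valid because the determinant is a null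
Lagrangian, and an upper bound, obtained from simple laminates supported in the coincidence set.

Lower bound. Since φ ≥ |det| everywhere, it suffices that the integral of det is fixed by the
barycenter (or by zero boundary values), for then ∫ φ ≥ ∫ |det| ≥ |∫ det| = |det F|. For zero
boundary values (`integral_det_add_gradMatrix`), adding a large multiple of the identity turns x ↦
Fx + u(x) into a bijection with positive Jacobian. It maps the domain onto the same set as the
unperturbed linear map does, so the area formula gives equality. The shift is then removed by
polynomial interpolation. Young measures (`tendsto_setIntegral_det_gradMatrix`) reduce to this case:
the maps, minus their affine limit, are truncated by the distance to the boundary of a ball, which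
changes the gradient at almost every point only finitely often along the sequence.

Upper bound. Every F is the midpoint of two matrices F ± a ⊗ n in the coincidence set whose mean
absolute determinant is at most |det F| + ε (`exists_rankOne_split`). If the row f = F⁽ʲ⁾ splits as
g + κc, with c the row of cofactors and g ⊥ c, both nonzero multiples, the perturbation reflects the
tilt of the other rows against g so that row j becomes orthogonal to all of them. For det F ≠ 0 the
two determinants are 0 and 2 det F, of the same sign, so |·| is additive on them. For det F = 0 they
are opposite numbers of size at most ε. Rank-one connectedness makes the two matrices the gradients
of fine layers (`exists_laminate_sequence`), which serve for the Young measure and for the classical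
formula alike.

For the product of norms, det F is the inner product of F⁽ʲ⁾ and adj⁽ʲ⁾F: the bound by |det| is
Cauchy–Schwarz, with equality on the coincidence set because the vectors are parallel there. -/

/-- The **matrix determinant lemma** for a real matrix that need not be invertible. -/
theorem det_add_vecMulVec {n : Type*} [Fintype n] [DecidableEq n] (A : Matrix n n ℝ)
    (u v : n → ℝ) :
    (A + Matrix.vecMulVec u v).det = A.det + v ⬝ᵥ A.adjugate.mulVec u := by
  have key : ∀ B : Matrix n n ℝ, B.det ≠ 0 →
      (B + Matrix.vecMulVec u v).det = B.det + v ⬝ᵥ B.adjugate.mulVec u := by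
    intro B hB
    have h1 := Matrix.det_add_replicateCol_mul_replicateRow (ι := Unit) (isUnit_iff_ne_zero.2 hB) u v
    rw [← Matrix.vecMulVec_eq] at h1
    have h2 : (1 + Matrix.replicateRow Unit v * B⁻¹ * Matrix.replicateCol Unit u).det
        = 1 + v ⬝ᵥ B⁻¹.mulVec u := by
      rw [Matrix.det_unique, Matrix.mul_assoc, ← Matrix.replicateCol_mulVec]
      simp [Matrix.mul_apply, dotProduct]
    rw [h1, h2, Matrix.inv_def, Matrix.smul_mulVec, dotProduct_smul, Ring.inverse_eq_inv',
      smul_eq_mul]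
    field_simp
  -- The singular shifts are the roots of a characteristic polynomial, hence finitely many. The
  -- identity then passes to s → 0 by continuity.
  have hinv : ∀ᶠ s : ℝ in 𝓝[≠] 0, (s • (1 : Matrix n n ℝ) + A).det ≠ 0 := by
    have hfin : {s : ℝ | (-A).charpoly.IsRoot s}.Finite :=
      Polynomial.finite_setOfPred_isRoot (-A).charpoly_monic.ne_zero
    have : ∀ᶠ s : ℝ in cofinite, ¬ (-A).charpoly.IsRoot s := by
      simpa [Filter.eventually_cofinite] using hfin
    filter_upwards [this.filter_mono (nhdsNE_le_cofinite 0)] with s hs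
    rwa [Polynomial.IsRoot, Matrix.eval_charpoly, Matrix.scalar_apply, sub_neg_eq_add,
      ← Matrix.smul_one_eq_diagonal] at hs
  have c1 : Tendsto (fun s : ℝ => (s • (1 : Matrix n n ℝ) + A + Matrix.vecMulVec u v).det)
      (𝓝[≠] 0) (𝓝 (((0 : ℝ) • (1 : Matrix n n ℝ) + A + Matrix.vecMulVec u v).det)) :=
    ((by fun_prop : Continuous fun s : ℝ =>
      (s • (1 : Matrix n n ℝ) + A + Matrix.vecMulVec u v).det).tendsto 0).mono_left
      nhdsWithin_le_nhds
  have c2 : Tendsto (fun s : ℝ => (s • (1 : Matrix n n ℝ) + A).det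
        + v ⬝ᵥ (s • (1 : Matrix n n ℝ) + A).adjugate.mulVec u)
      (𝓝[≠] 0) (𝓝 (((0 : ℝ) • (1 : Matrix n n ℝ) + A).det
        + v ⬝ᵥ ((0 : ℝ) • (1 : Matrix n n ℝ) + A).adjugate.mulVec u)) :=
    ((by fun_prop : Continuous fun s : ℝ => (s • (1 : Matrix n n ℝ) + A).det
        + v ⬝ᵥ (s • (1 : Matrix n n ℝ) + A).adjugate.mulVec u).tendsto 0).mono_left
      nhdsWithin_le_nhds
  have := tendsto_nhds_unique (c1.congr' (hinv.mono fun s hs => key _ hs)) c2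
  simpa using this

/-! ### Rank-one splitting into the coincidence set -/

section Laminate

variable {N : ℕ}

theorem mem_coincidenceSet_inl {j : Fin N} {F : Matrix (Fin N) (Fin N) ℝ} :
    F ∈ coincidenceSet (Sum.inl j) ↔ ∃ α : ℝ, α • F j = F.adjugate.transpose j := by
  refine exists_congr fun α => ⟨fun h => ?_, fun h => ?_⟩
  · exact congrArg WithLp.ofLp h
  · exact congrArg (WithLp.toLp 2) h

theorem mem_coincidenceSet_inr {j : Fin N} {F : Matrix (Fin N) (Fin N) ℝ} :
    F ∈ coincidenceSet (Sum.inr j) ↔ F.transpose ∈ coincidenceSet (Sum.inl j) := by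
  rw [mem_coincidenceSet_inl, ← Matrix.adjugate_transpose]
  refine exists_congr fun α => ⟨fun h => ?_, fun h => ?_⟩
  · exact congrArg WithLp.ofLp h
  · exact congrArg (WithLp.toLp 2) h

/-- Cofactor expansion along alien rows: the row of cofactors is orthogonal to every row of `F`
except row `j`. -/
theorem mulVec_cofactorRow (F : Matrix (Fin N) (Fin N) ℝ) (j : Fin N) :
    F.mulVec (F.adjugate.transpose j) = F.det • Pi.single j 1 := by
  ext i
  have := congrFun (congrFun F.mul_adjugate i) j
  simpa [Matrix.mul_apply, Matrix.mulVec, dotProduct, Matrix.one_apply, Pi.single_apply] using this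

/-- Orthogonality says that `F` maps its own row `j` to a multiple of the basis vector `j`. Applying
the adjugate makes that row, times det F, a multiple of the row of cofactors. This replaces a
condition on cofactors by one on inner products. -/
theorem mem_coincidenceSet_of_orthogonal {j : Fin N} {F : Matrix (Fin N) (Fin N) ℝ}
    (h0 : F j ≠ 0) (h : ∀ i, i ≠ j → F i ⬝ᵥ F j = 0) : F ∈ coincidenceSet (Sum.inl j) := by
  have h1 : F.mulVec (F j) = (F j ⬝ᵥ F j) • Pi.single j 1 := by
    ext i
    by_cases hi : i = j
    · subst hi; simp [Matrix.mulVec]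
    · simpa [Matrix.mulVec, hi] using h i hi
  have h2 := congrArg F.adjugate.mulVec h1
  rw [Matrix.mulVec_mulVec, Matrix.adjugate_mul, Matrix.mulVec_smul, Matrix.smul_mulVec,
    Matrix.one_mulVec, Matrix.mulVec_single_one] at h2
  have h3 : F j ⬝ᵥ F j ≠ 0 := by simpa [dotProduct_self_eq_zero] using h0
  refine mem_coincidenceSet_inl.2 ⟨F.det / (F j ⬝ᵥ F j), ?_⟩
  rw [div_eq_inv_mul, mul_smul, h2, smul_smul, inv_mul_cancel₀ h3, one_smul]
  rfl

/-- A rank-one perturbation that makes the row `j` orthogonal to the remaining rows. Here `c` is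
the row of cofactors, `g` the component of the row orthogonal to `c`. -/
theorem rankOne_perturbation {j : Fin N} {F : Matrix (Fin N) (Fin N) ℝ} {c g n : Fin N → ℝ}
    {κ μ s : ℝ} (hc : c = F.adjugate.transpose j) (hc0 : c ⬝ᵥ c ≠ 0) (hF : F j = g + κ • c)
    (hgc : g ⬝ᵥ c = 0) (hg0 : g ⬝ᵥ g ≠ 0) (hn : n = g + μ • c) (hκμ : κ * μ = 0)
    (hne : κ + s * μ ≠ 0) (hs : s ^ 2 * (n ⬝ᵥ n) = g ⬝ᵥ g) :
    F + s • Matrix.vecMulVec ((2 : ℝ) • Pi.single j 1 - (g ⬝ᵥ g)⁻¹ • F.mulVec g) n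
        ∈ coincidenceSet (Sum.inl j) ∧
      (F + s • Matrix.vecMulVec ((2 : ℝ) • Pi.single j 1 - (g ⬝ᵥ g)⁻¹ • F.mulVec g) n).det
        = F.det + s * (2 * μ * (c ⬝ᵥ c) - F.det) := by
  set a : Fin N → ℝ := (2 : ℝ) • Pi.single j 1 - (g ⬝ᵥ g)⁻¹ • F.mulVec g with ha
  have hFc : F.mulVec c = F.det • Pi.single j 1 := hc ▸ mulVec_cofactorRow F j
  have hcg : c ⬝ᵥ g = 0 := by rw [dotProduct_comm, hgc]
  have hFi : ∀ i, i ≠ j → F i ⬝ᵥ c = 0 := fun i hi => by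
    simpa [Matrix.mulVec, hi] using congrFun hFc i
  have hng : n ⬝ᵥ g = g ⬝ᵥ g := by simp [hn, add_dotProduct, hcg]
  have hnc : n ⬝ᵥ c = μ * (c ⬝ᵥ c) := by simp [hn, add_dotProduct, hgc]
  -- Thus row `j` of the perturbed matrix is (1 + s)g + (κ + sμ)c, and any other row i is F_i − s
  -- (F_i·g)/|g|² n. The condition on s² cancels their inner product, for either sign of s.
  have haj : a j = 1 := by
    have : F.mulVec g j = g ⬝ᵥ g := by
      change F j ⬝ᵥ g = _
      simp [hF, add_dotProduct, hcg]
    simp [ha, this, hg0]; norm_num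
  have hai : ∀ i, i ≠ j → a i = -((g ⬝ᵥ g)⁻¹ * (F i ⬝ᵥ g)) := fun i hi => by
    simp [ha, hi, Matrix.mulVec]
  have hrow : ∀ i, (F + s • Matrix.vecMulVec a n) i = F i + (s * a i) • n := fun i => by
    ext k; simp [Matrix.vecMulVec_apply, mul_assoc]
  constructor
  · apply mem_coincidenceSet_of_orthogonal
    -- The row is nonzero because its component along c is κ + sμ.
    · intro h
      have h1 := congrArg (· ⬝ᵥ c) h
      simp only [hrow, haj, hF, add_dotProduct, smul_dotProduct, hgc, hnc, zero_dotProduct,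
        smul_eq_mul] at h1
      apply hne
      apply mul_right_cancel₀ hc0
      linarith
    · intro i hi
      simp only [hrow, haj, hai i hi]
      simp only [hF, add_dotProduct, smul_dotProduct, dotProduct_add, dotProduct_smul, hnc, hng,
        smul_eq_mul, hFi i hi]
      have h1 : F i ⬝ᵥ n = F i ⬝ᵥ g := by
        simp [hn, dotProduct_add, hFi i hi]
      rw [h1]
      have h2 : μ * κ = 0 := by linarith
      field_simp
      linear_combination (-(F i ⬝ᵥ g)) * hs - (F i ⬝ᵥ g) * s * (c ⬝ᵥ c) * hκμ
  · rw [← Matrix.smul_vecMulVec, det_add_vecMulVec, Matrix.mulVec_smul, ha, Matrix.mulVec_sub,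
      Matrix.mulVec_smul, Matrix.mulVec_smul, Matrix.mulVec_mulVec, Matrix.adjugate_mul,
      Matrix.mulVec_single_one, Matrix.smul_mulVec, Matrix.one_mulVec]
    have h1 : F.adjugate.col j = c := hc.symm
    simp only [h1, dotProduct_smul, dotProduct_sub, hnc, hng, smul_eq_mul]
    field_simp

theorem exists_rankOne_split_row (j : Fin N) (F : Matrix (Fin N) (Fin N) ℝ) {ε : ℝ} (hε : 0 < ε) :
    ∃ a n : Fin N → ℝ, n ≠ 0 ∧
      F + Matrix.vecMulVec a n ∈ coincidenceSet (Sum.inl j) ∧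
      F - Matrix.vecMulVec a n ∈ coincidenceSet (Sum.inl j) ∧
      |(F + Matrix.vecMulVec a n).det| + |(F - Matrix.vecMulVec a n).det|
        ≤ 2 * (|F.det| + ε) := by
  by_cases hF : F ∈ coincidenceSet (Sum.inl j)
  · refine ⟨0, Pi.single j 1, by simp, by simpa using hF, by simpa using hF, ?_⟩
    simp; linarith
  set c := F.adjugate.transpose j with hc
  have hFc : F.mulVec c = F.det • Pi.single j 1 := mulVec_cofactorRow F j
  have hc0 : c ≠ 0 := fun h => hF (mem_coincidenceSet_inl.2 ⟨0, by rw [← hc, h, zero_smul]⟩)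
  have hcc : c ⬝ᵥ c ≠ 0 := by simpa [dotProduct_self_eq_zero] using hc0
  have hcpos : 0 < c ⬝ᵥ c := lt_of_le_of_ne (by simpa using dotProduct_star_self_nonneg c) hcc.symm
  have hfc : F j ⬝ᵥ c = F.det := by simpa [Matrix.mulVec] using congrFun hFc j
  obtain ⟨κ, hκ⟩ : ∃ κ, κ = F.det / (c ⬝ᵥ c) := ⟨_, rfl⟩
  have hκ' : κ * (c ⬝ᵥ c) = F.det := by rw [hκ]; field_simp
  obtain ⟨g, hg⟩ : ∃ g, g = F j - κ • c := ⟨_, rfl⟩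
  have hFg : F j = g + κ • c := by simp [hg]
  have hgc : g ⬝ᵥ c = 0 := by
    simp [hg, sub_dotProduct, hfc, hκ']
  -- With g = 0 and F outside the coincidence set, row `j` must vanish. Its cofactors do not depend
  -- on it, so replacing the row by ±(ε/|c|²)c gives membership and determinants ±ε.
  by_cases hg0 : g = 0
  · have hκ0 : κ = 0 := by
      by_contra h
      refine hF (mem_coincidenceSet_inl.2 ⟨κ⁻¹, ?_⟩)
      rw [hFg, hg0, zero_add, smul_smul, inv_mul_cancel₀ h, one_smul]
    have hd : F.det = 0 := by rw [← hκ', hκ0, zero_mul]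
    have hF0 : F j = 0 := by rw [hFg, hg0, hκ0]; simp
    have hrow : ∀ s : ℝ, F + Matrix.vecMulVec (s • Pi.single j 1) c = F.updateRow j (s • c) := by
      intro s
      ext i k
      by_cases hi : i = j
      · subst hi; simp [Matrix.vecMulVec_apply, hF0]
      · simp [Matrix.vecMulVec_apply, hi]
    have hadj : ∀ s : ℝ, (F.updateRow j (s • c)).adjugate.transpose j = c := by
      intro s
      rw [hc]
      ext k
      rw [Matrix.transpose_apply, Matrix.transpose_apply, Matrix.adjugate_apply,
        Matrix.adjugate_apply, Matrix.updateRow_idem]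
    have hdet : ∀ s : ℝ, (F.updateRow j (s • c)).det = s * (c ⬝ᵥ c) := by
      intro s
      rw [← hrow, det_add_vecMulVec, Matrix.mulVec_smul, Matrix.mulVec_single_one, hd]
      simp only [dotProduct_smul, zero_add, smul_eq_mul]; rfl
    have hmem : ∀ s : ℝ, s ≠ 0 → F.updateRow j (s • c) ∈ coincidenceSet (Sum.inl j) := by
      intro s hs
      refine mem_coincidenceSet_inl.2 ⟨s⁻¹, ?_⟩
      rw [hadj, Matrix.updateRow_self, smul_smul, inv_mul_cancel₀ hs, one_smul]
    have hs0 : ε / (c ⬝ᵥ c) ≠ 0 := by positivity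
    refine ⟨(ε / (c ⬝ᵥ c)) • Pi.single j 1, c, hc0, ?_, ?_, ?_⟩
    · rw [hrow]; exact hmem _ hs0
    · rw [sub_eq_add_neg, ← Matrix.neg_vecMulVec, ← neg_smul, hrow]
      exact hmem _ (neg_ne_zero.2 hs0)
    · rw [sub_eq_add_neg, ← Matrix.neg_vecMulVec, ← neg_smul, hrow, hrow, hdet, hdet, neg_mul,
        abs_neg, div_mul_cancel₀ _ hcc, hd, abs_of_pos hε]
      simp; linarith
  · have hgg : g ⬝ᵥ g ≠ 0 := by simpa [dotProduct_self_eq_zero] using hg0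
    have hgpos : 0 < g ⬝ᵥ g :=
      lt_of_le_of_ne (by simpa using dotProduct_star_self_nonneg g) hgg.symm
    -- For det F ≠ 0 no correction is needed: n = g and t = 1. For det F = 0 the small component
    -- along c keeps row `j` nonzero and in the coincidence set; the value of μ makes the
    -- determinants ±tε.
    obtain ⟨μ, hμ⟩ : ∃ μ : ℝ, μ = if κ = 0 then ε / (2 * (c ⬝ᵥ c)) else 0 := ⟨_, rfl⟩
    have hμ0 : 0 ≤ μ := by rw [hμ]; split_ifs <;> positivity
    have hκμ : κ * μ = 0 := by rw [hμ]; split_ifs with h <;> simp [h]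
    obtain ⟨n, hn⟩ : ∃ n, n = g + μ • c := ⟨_, rfl⟩
    have hcg : c ⬝ᵥ g = 0 := by rw [dotProduct_comm, hgc]
    have hnn : n ⬝ᵥ n = g ⬝ᵥ g + μ ^ 2 * (c ⬝ᵥ c) := by
      simp [hn, add_dotProduct, hgc, hcg]; ring
    have hnpos : 0 < n ⬝ᵥ n := by rw [hnn]; positivity
    obtain ⟨t, ht⟩ : ∃ t : ℝ, t = √((g ⬝ᵥ g) / (n ⬝ᵥ n)) := ⟨_, rfl⟩
    have htpos : 0 < t := by rw [ht]; positivity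
    have ht2 : t ^ 2 * (n ⬝ᵥ n) = g ⬝ᵥ g := by
      rw [ht, Real.sq_sqrt (by positivity)]; field_simp
    have ht1 : t ≤ 1 := by
      rw [ht]; apply Real.sqrt_le_one.2
      rw [div_le_one hnpos, hnn]; nlinarith [sq_nonneg μ]
    have hne : ∀ s : ℝ, s ≠ 0 → κ + s * μ ≠ 0 := by
      intro s hs
      by_cases h : κ = 0
      · rw [hμ, if_pos h, h, zero_add]; positivity
      · rw [hμ, if_neg h]; simpa using h
    obtain ⟨m1, d1⟩ := rankOne_perturbation hc hcc hFg hgc hgg hn hκμ (hne t htpos.ne') ht2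
    obtain ⟨m2, d2⟩ := rankOne_perturbation (s := -t) hc hcc hFg hgc hgg hn hκμ
      (hne (-t) (neg_ne_zero.2 htpos.ne')) (by rw [neg_sq]; exact ht2)
    rw [← Matrix.smul_vecMulVec] at m1 d1
    rw [neg_smul, ← Matrix.smul_vecMulVec, ← sub_eq_add_neg] at m2 d2
    refine ⟨_, n, ?_, m1, m2, ?_⟩
    · rintro rfl; simp at hnpos
    · rw [d1, d2]
      by_cases h : κ = 0
      · have hd : F.det = 0 := by rw [← hκ', h, zero_mul]
        have h1 : 2 * μ * (c ⬝ᵥ c) = ε := by rw [hμ, if_pos h]; field_simp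
        rw [hd, h1]
        simp only [zero_add, sub_zero, neg_mul, abs_neg, abs_mul, abs_of_pos htpos, abs_of_pos hε,
          abs_zero]
        nlinarith
      · have h1 : μ = 0 := by rw [hμ, if_neg h]
        rw [h1]
        have e1 : F.det + t * (2 * 0 * (c ⬝ᵥ c) - F.det) = (1 - t) * F.det := by ring
        have e2 : F.det + -t * (2 * 0 * (c ⬝ᵥ c) - F.det) = (1 + t) * F.det := by ring
        rw [e1, e2, abs_mul, abs_mul, abs_of_nonneg (by linarith : 0 ≤ 1 - t),
          abs_of_nonneg (by linarith : 0 ≤ 1 + t)]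
        linarith

/-- Every matrix is the midpoint of two rank-one connected matrices of the coincidence set whose
mean absolute determinant is almost that of the given matrix. -/
theorem exists_rankOne_split (j : Fin N ⊕ Fin N) (F : Matrix (Fin N) (Fin N) ℝ) {ε : ℝ}
    (hε : 0 < ε) :
    ∃ a n : Fin N → ℝ, n ≠ 0 ∧
      F + Matrix.vecMulVec a n ∈ coincidenceSet j ∧
      F - Matrix.vecMulVec a n ∈ coincidenceSet j ∧
      |(F + Matrix.vecMulVec a n).det| + |(F - Matrix.vecMulVec a n).det|
        ≤ 2 * (|F.det| + ε) := by
  rcases j with j | j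
  · exact exists_rankOne_split_row j F hε
  · obtain ⟨a, n, h0, h1, h2, h3⟩ := exists_rankOne_split_row j F.transpose hε
    -- Transposition exchanges the roles of a and n, so a must be a legitimate (nonzero) layer
    -- normal. If a = 0, F itself lies in the coincidence set and the trivial splitting serves.
    by_cases ha : a = 0
    · subst ha
      refine ⟨0, n, h0, ?_, ?_, ?_⟩
      · rw [mem_coincidenceSet_inr]; simpa using h1
      · rw [mem_coincidenceSet_inr]; simpa using h1
      · simp; linarith
    have e1 : (F + Matrix.vecMulVec n a).transpose = F.transpose + Matrix.vecMulVec a n := by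
      rw [Matrix.transpose_add, Matrix.transpose_vecMulVec]
    have e2 : (F - Matrix.vecMulVec n a).transpose = F.transpose - Matrix.vecMulVec a n := by
      rw [Matrix.transpose_sub, Matrix.transpose_vecMulVec]
    refine ⟨n, a, ha, ?_, ?_, ?_⟩
    · rwa [mem_coincidenceSet_inr, e1]
    · rwa [mem_coincidenceSet_inr, e2]
    · rwa [← Matrix.det_transpose, e1, ← Matrix.det_transpose (F - _), e2, ← Matrix.det_transpose F]

end Laminate

/-! ### Gradients of Lipschitz maps as matrices -/

section GradMatrix

variable {m N : ℕ}

/-- The bound holds at every point, since `fderiv` is zero where the map is not differentiable. -/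
theorem abs_gradMatrix_le {u : EuclideanSpace ℝ (Fin N) → EuclideanSpace ℝ (Fin m)} {K : NNReal}
    (hu : LipschitzWith K u) (x : EuclideanSpace ℝ (Fin N)) (i : Fin m) (j : Fin N) :
    |gradMatrix u x i j| ≤ K :=
  calc |gradMatrix u x i j| = ‖(fderiv ℝ u x (EuclideanSpace.single j 1)) i‖ := rfl
    _ ≤ ‖fderiv ℝ u x (EuclideanSpace.single j 1)‖ := PiLp.norm_apply_le _ _
    _ ≤ ‖fderiv ℝ u x‖ * ‖EuclideanSpace.single j (1 : ℝ)‖ := ContinuousLinearMap.le_opNorm _ _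
    _ ≤ K := by simpa using norm_fderiv_le_of_lipschitz ℝ hu

theorem measurable_gradMatrix (u : EuclideanSpace ℝ (Fin N) → EuclideanSpace ℝ (Fin m)) :
    Measurable (gradMatrix u) := by
  refine measurable_pi_lambda _ fun i => measurable_pi_lambda _ fun j => ?_
  have h := measurable_fderiv_apply_const ℝ u (EuclideanSpace.single j 1)
  exact (EuclideanSpace.proj (𝕜 := ℝ) i).continuous.measurable.comp h

theorem toEuclideanCLM_gradMatrix
    (u : EuclideanSpace ℝ (Fin N) → EuclideanSpace ℝ (Fin N)) (x : EuclideanSpace ℝ (Fin N)) :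
    Matrix.toEuclideanCLM (𝕜 := ℝ) (gradMatrix u x) = fderiv ℝ u x := by
  apply ContinuousLinearMap.coe_injective
  refine (EuclideanSpace.basisFun (Fin N) ℝ).toBasis.ext fun j => ?_
  ext i
  simp [gradMatrix]

theorem det_toEuclideanCLM (A : Matrix (Fin N) (Fin N) ℝ) :
    (Matrix.toEuclideanCLM (𝕜 := ℝ) A).det = A.det := by
  rw [ContinuousLinearMap.det, Matrix.coe_toEuclideanCLM_eq_toEuclideanLin]
  exact LinearMap.det_toLpLin _ A

theorem gradMatrix_eq_of_hasFDerivAt {u : EuclideanSpace ℝ (Fin N) → EuclideanSpace ℝ (Fin N)}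
    {x : EuclideanSpace ℝ (Fin N)} {A : Matrix (Fin N) (Fin N) ℝ}
    (h : HasFDerivAt u (Matrix.toEuclideanCLM (𝕜 := ℝ) A) x) : gradMatrix u x = A := by
  refine (Matrix.toEuclideanCLM (n := Fin N) (𝕜 := ℝ)).injective ?_
  change Matrix.toEuclideanCLM (𝕜 := ℝ) _ = Matrix.toEuclideanCLM (𝕜 := ℝ) _
  rw [toEuclideanCLM_gradMatrix, h.fderiv]

theorem hasFDerivAt_gradMatrix {u : EuclideanSpace ℝ (Fin N) → EuclideanSpace ℝ (Fin N)}
    {x : EuclideanSpace ℝ (Fin N)} (h : DifferentiableAt ℝ u x) :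
    HasFDerivAt u (Matrix.toEuclideanCLM (𝕜 := ℝ) (gradMatrix u x)) x := by
  rw [toEuclideanCLM_gradMatrix]; exact h.hasFDerivAt

/-- A box of matrices is compact. This supplies the constant bounds needed for integrability and
dominated convergence along uniformly Lipschitz maps. -/
theorem Continuous.exists_abs_le_of_entries_le {ψ : Matrix (Fin m) (Fin N) ℝ → ℝ}
    (hψ : Continuous ψ) (R : ℝ) :
    ∃ C : ℝ, 0 ≤ C ∧ ∀ A : Matrix (Fin m) (Fin N) ℝ, (∀ i k, |A i k| ≤ R) → |ψ A| ≤ C := by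
  have hc : IsCompact (Set.univ.pi fun _ : Fin m => Set.univ.pi fun _ : Fin N => Set.Icc (-R) R) :=
    isCompact_univ_pi fun _ => isCompact_univ_pi fun _ => isCompact_Icc
  obtain ⟨C, hC⟩ := hc.exists_bound_of_continuousOn (f := ψ) hψ.continuousOn
  refine ⟨max C 0, le_max_right _ _, fun A hA => (hC A ?_).trans (le_max_left _ _)⟩
  exact fun i _ k _ => Set.mem_Icc.2 (abs_le.1 (hA i k))

end GradMatrix

/-! ### The determinant as a null Lagrangian -/

section NullLagrangian

variable {N : ℕ}

/-- Lipschitz maps enlarge Hausdorff measure by at most a constant factor, and in dimension N it has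
the same null sets as volume. -/
theorem LipschitzWith.volume_image_eq_zero
    {u : EuclideanSpace ℝ (Fin N) → EuclideanSpace ℝ (Fin N)} {K : NNReal}
    (hu : LipschitzWith K u) {s : Set (EuclideanSpace ℝ (Fin N))} (hs : volume s = 0) :
    volume (u '' s) = 0 := by
  have h1 : (μH[N] : Measure (EuclideanSpace ℝ (Fin N))) s = 0 :=
    Measure.absolutelyContinuous_isAddHaarMeasure _ volume hs
  have h2 : (μH[N] : Measure (EuclideanSpace ℝ (Fin N))) (u '' s) = 0 := by
    refine le_antisymm ((hu.hausdorffMeasure_image_le (Nat.cast_nonneg N) s).trans ?_) zero_le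
    simp [h1]
  exact Measure.absolutelyContinuous_isAddHaarMeasure volume (μH[N]) h2

theorem bijective_add_of_lipschitzWith_lt_one {E : Type*} [NormedAddCommGroup E] [NormedSpace ℝ E]
    [CompleteSpace E] {v : E → E} {c : NNReal} (hv : LipschitzWith c v) (hc : c < 1) :
    Function.Bijective fun x => x + v x := by
  have ha : ApproximatesLinearOn (fun x => x + v x)
      ((ContinuousLinearEquiv.refl ℝ E : E ≃L[ℝ] E) : E →L[ℝ] E) Set.univ c := by
    rw [ApproximatesLinearOn.approximatesLinearOn_iff_lipschitzOnWith, lipschitzOnWith_univ]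
    convert! hv using 1
    ext x
    simp
  have hc' : Subsingleton E ∨
      c < ‖((ContinuousLinearEquiv.refl ℝ E).symm : E →L[ℝ] E)‖₊⁻¹ := by
    rcases subsingleton_or_nontrivial E with h | h
    · exact Or.inl h
    · right
      have : ‖((ContinuousLinearEquiv.refl ℝ E).symm : E →L[ℝ] E)‖₊ = 1 := by
        simp
      rwa [this, inv_one]
  exact ⟨Set.injOn_univ.1 (ha.injOn hc'), ha.surjective hc'⟩

/-- det(sI + A) = sᴺ det(I + A/s), and the determinant is positive near the identity. -/
theorem exists_forall_det_smul_one_add_pos (R : ℝ) :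
    ∃ s₀ : ℝ, 0 < s₀ ∧ ∀ s, s₀ ≤ s → ∀ A : Matrix (Fin N) (Fin N) ℝ, (∀ i k, |A i k| ≤ R) →
      0 < (s • (1 : Matrix (Fin N) (Fin N) ℝ) + A).det := by
  have hcont : Continuous fun B : Fin N → Fin N → ℝ =>
      ((1 : Matrix (Fin N) (Fin N) ℝ) + Matrix.of B).det :=
    (continuous_const.add (continuous_id (X := Fin N → Fin N → ℝ))).matrix_det
  have hopen : {B : Fin N → Fin N → ℝ | 0 < ((1 : Matrix (Fin N) (Fin N) ℝ) + Matrix.of B).det}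
      ∈ 𝓝 0 := by
    refine (isOpen_lt continuous_const hcont).mem_nhds ?_
    change 0 < ((1 : Matrix (Fin N) (Fin N) ℝ) + 0).det
    simp
  obtain ⟨δ, hδ, hball⟩ := Metric.mem_nhds_iff.1 hopen
  refine ⟨(|R| + 1) / δ, by positivity, fun s hs A hA => ?_⟩
  have hs0 : 0 < s := lt_of_lt_of_le (by positivity) hs
  have hmem : (fun i k => s⁻¹ * A i k : Fin N → Fin N → ℝ) ∈ Metric.ball 0 δ := by
    rw [mem_ball_zero_iff, pi_norm_lt_iff hδ]
    intro i
    rw [pi_norm_lt_iff hδ]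
    intro k
    rw [Real.norm_eq_abs, abs_mul, abs_of_pos (inv_pos.2 hs0), inv_mul_lt_iff₀ hs0]
    rw [div_le_iff₀ hδ] at hs
    linarith [hA i k, le_abs_self R]
  have h1 := hball hmem
  have h2 : s • (1 : Matrix (Fin N) (Fin N) ℝ) + A
      = s • ((1 : Matrix (Fin N) (Fin N) ℝ) + Matrix.of fun i k => s⁻¹ * A i k) := by
    ext i k
    simp [mul_add, mul_inv_cancel_left₀ hs0.ne']
  rw [h2, Matrix.det_smul]
  exact mul_pos (pow_pos hs0 _) h1

/-- The determinant is a fixed linear combination of its values after shifts along the identity. -/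
theorem exists_det_eq_sum_det_smul_one_add (s : ℕ → ℝ) (hs : Function.Injective s) :
    ∃ l : ℕ → ℝ, ∀ A : Matrix (Fin N) (Fin N) ℝ,
      A.det = ∑ i ∈ Finset.range (N + 1), l i * (s i • (1 : Matrix (Fin N) (Fin N) ℝ) + A).det := by
  -- det(sI + A) is the characteristic polynomial of −A at s, of degree N. Lagrange interpolation at
  -- N + 1 nodes recovers its value at 0 with weights that depend on the nodes alone.
  refine ⟨fun i => (Lagrange.basis (Finset.range (N + 1)) s i).eval 0, fun A => ?_⟩
  have hev : ∀ r : ℝ, (-A).charpoly.eval r = (r • (1 : Matrix (Fin N) (Fin N) ℝ) + A).det := by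
    intro r
    rw [Matrix.eval_charpoly, Matrix.scalar_apply, sub_neg_eq_add, ← Matrix.smul_one_eq_diagonal]
  have hdeg : (-A).charpoly.degree < (Finset.range (N + 1)).card := by
    rw [Matrix.charpoly_degree_eq_dim, Finset.card_range, Fintype.card_fin]
    exact_mod_cast Nat.lt_succ_self N
  have h := congrArg (Polynomial.eval 0) (Lagrange.eq_interpolate (v := s) hs.injOn hdeg)
  rw [hev, zero_smul, zero_add, Lagrange.interpolate_apply, Polynomial.eval_finsetSum] at h
  rw [h]
  refine Finset.sum_congr rfl fun i _ => ?_
  rw [Polynomial.eval_mul, Polynomial.eval_C, hev, mul_comm]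

/-- Area formula for an injective map. By Rademacher's theorem the points of non-differentiability
form a null set, and so does its Lipschitz image. -/
theorem lintegral_abs_det_add_gradMatrix_eq_image
    {u : EuclideanSpace ℝ (Fin N) → EuclideanSpace ℝ (Fin N)} {K : NNReal}
    (hu : LipschitzWith K u) {D : Set (EuclideanSpace ℝ (Fin N))} (hD : MeasurableSet D)
    {G : EuclideanSpace ℝ (Fin N) → EuclideanSpace ℝ (Fin N)} (A : Matrix (Fin N) (Fin N) ℝ)
    (hG : ∀ x, G x = Matrix.toEuclideanCLM (𝕜 := ℝ) A x + u x) (hinj : Function.Injective G) :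
    ∫⁻ x in D, ENNReal.ofReal |(A + gradMatrix u x).det| = volume (G '' D) := by
  obtain rfl : G = fun x => Matrix.toEuclideanCLM (𝕜 := ℝ) A x + u x := funext hG
  set G := fun x => Matrix.toEuclideanCLM (𝕜 := ℝ) A x + u x
  set S := {x | DifferentiableAt ℝ u x}
  have hS : MeasurableSet S := measurableSet_of_differentiableAt ℝ u
  have hSnull : volume Sᶜ = 0 := hu.ae_differentiableAt
  have hGlip := (Matrix.toEuclideanCLM (𝕜 := ℝ) A).lipschitz.add hu
  have h1 : ∫⁻ x in D ∩ S, ENNReal.ofReal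
      |(Matrix.toEuclideanCLM (𝕜 := ℝ) (A + gradMatrix u x)).det| = volume (G '' (D ∩ S)) := by
    refine lintegral_abs_det_fderiv_eq_addHaar_image volume (hD.inter hS) (fun x hx => ?_)
      hinj.injOn
    rw [map_add]
    exact ((Matrix.toEuclideanCLM (𝕜 := ℝ) A).hasFDerivAt.add
      (hasFDerivAt_gradMatrix hx.2)).hasFDerivWithinAt
  simp_rw [det_toEuclideanCLM] at h1
  have h2 : (D ∩ S : Set _) =ᵐ[volume] D :=
    inter_ae_eq_left_of_ae_eq_univ (by rw [ae_eq_univ]; exact hSnull)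
  rw [setLIntegral_congr h2] at h1
  rw [h1]
  refine le_antisymm (measure_mono (Set.image_mono Set.inter_subset_left)) ?_
  calc volume (G '' D) ≤ volume (G '' (D ∩ S) ∪ G '' Sᶜ) := by
        rw [← Set.image_union]
        exact measure_mono (Set.image_mono fun x hx => by
          by_cases h : x ∈ S
          · exact Or.inl ⟨hx, h⟩
          · exact Or.inr h)
    _ ≤ volume (G '' (D ∩ S)) + volume (G '' Sᶜ) := measure_union_le _ _
    _ = volume (G '' (D ∩ S)) := by
        rw [LipschitzWith.volume_image_eq_zero hGlip hSnull, add_zero]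

theorem integrableOn_det_add_gradMatrix
    {u : EuclideanSpace ℝ (Fin N) → EuclideanSpace ℝ (Fin N)} {K : NNReal}
    (hu : LipschitzWith K u) {D : Set (EuclideanSpace ℝ (Fin N))} (hfin : volume D ≠ ⊤)
    (F : Matrix (Fin N) (Fin N) ℝ) :
    IntegrableOn (fun x => (F + gradMatrix u x).det) D := by
  have hcont : Continuous fun A : Matrix (Fin N) (Fin N) ℝ => (F + A).det := by fun_prop
  obtain ⟨C, -, hC⟩ := hcont.exists_abs_le_of_entries_le K
  have : IsFiniteMeasure (volume.restrict D) := ⟨by simpa using hfin.lt_top⟩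
  refine Integrable.of_bound (C := C)
    (hcont.measurable.comp (measurable_gradMatrix u)).aestronglyMeasurable ?_
  exact Eventually.of_forall fun x => hC _ (abs_gradMatrix_le hu x)

/-- The determinant is a **null Lagrangian**, for Lipschitz perturbations with zero boundary
values. -/
theorem integral_det_add_gradMatrix
    {u : EuclideanSpace ℝ (Fin N) → EuclideanSpace ℝ (Fin N)} {K : NNReal}
    (hu : LipschitzWith K u) {D : Set (EuclideanSpace ℝ (Fin N))} (hD : MeasurableSet D)
    (hfin : volume D ≠ ⊤) (h0 : ∀ x, x ∉ D → u x = 0) (F : Matrix (Fin N) (Fin N) ℝ) :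
    ∫ x in D, (F + gradMatrix u x).det = volume.real D * F.det := by
  obtain ⟨R, hR⟩ : ∃ R : ℝ, ∀ i k, |F i k| ≤ R :=
    ⟨∑ i, ∑ k, |F i k|, fun i k =>
      (Finset.single_le_sum (f := fun k => |F i k|) (fun _ _ => abs_nonneg _)
        (Finset.mem_univ k)).trans
      (Finset.single_le_sum (f := fun i => ∑ k, |F i k|)
        (fun _ _ => Finset.sum_nonneg fun _ _ => abs_nonneg _) (Finset.mem_univ i))⟩
  obtain ⟨s₀, hs₀, hpos⟩ := exists_forall_det_smul_one_add_pos (N := N) (R + K)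
  set T := Matrix.toEuclideanCLM (n := Fin N) (𝕜 := ℝ)
  have hlarge : ∀ s : ℝ, s₀ ≤ s → ‖T F‖ + K < s →
      ∫ x in D, (s • (1 : Matrix (Fin N) (Fin N) ℝ) + (F + gradMatrix u x)).det
        = volume.real D * (s • (1 : Matrix (Fin N) (Fin N) ℝ) + F).det := by
    intro s hs hs'
    have hsp : 0 < s := hs₀.trans_le hs
    -- Written as s(x + s⁻¹(Fx + v(x))), the map is a dilation of a contractive perturbation of the
    -- identity.
    have hbij : ∀ v : EuclideanSpace ℝ (Fin N) → EuclideanSpace ℝ (Fin N), LipschitzWith K v →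
        Function.Bijective fun x => T (s • 1 + F) x + v x := by
      intro v hv
      have hl : LipschitzWith (‖T F‖₊ + K) fun x => T F x + v x := (T F).lipschitz.add hv
      have hl2 := (lipschitzWith_smul (β := EuclideanSpace ℝ (Fin N)) s⁻¹).comp hl
      have hlt : ‖s⁻¹‖₊ * (‖T F‖₊ + K) < 1 := by
        rw [← NNReal.coe_lt_coe]
        push_cast
        rw [norm_inv, Real.norm_of_nonneg hsp.le, inv_mul_lt_iff₀ hsp,
          mul_one]
        exact hs'
      have hb := (bijective_add_of_lipschitzWith_lt_one hl2 hlt)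
      have hb2 := (MulAction.bijective (α := ℝˣ) (β := EuclideanSpace ℝ (Fin N))
        (Units.mk0 s hsp.ne')).comp hb
      convert! hb2 using 1
      ext1 x
      simp [Units.smul_def, smul_add, smul_inv_smul₀ hsp.ne', map_add, add_assoc]
    have e1 := lintegral_abs_det_add_gradMatrix_eq_image hu hD (s • 1 + F) (fun _ => rfl)
      (hbij u hu).1
    have hz : LipschitzWith K fun _ : EuclideanSpace ℝ (Fin N) => (0 : EuclideanSpace ℝ (Fin N)) :=
      (LipschitzWith.const _).weaken zero_le
    have e2 := lintegral_abs_det_add_gradMatrix_eq_image hz hD (s • 1 + F) (fun _ => rfl)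
      (hbij _ hz).1
    -- The two bijections agree off D, so they map the complement of D, and hence D, onto the same
    -- set.
    have himg : (fun x => T (s • 1 + F) x + u x) '' D
        = (fun x => T (s • 1 + F) x + (0 : EuclideanSpace ℝ (Fin N))) '' D := by
      rw [← compl_inj_iff, ← Set.image_compl_eq (hbij u hu), ← Set.image_compl_eq (hbij _ hz)]
      exact Set.image_congr fun x hx => by rw [h0 x hx]
    have hgz : ∀ x, gradMatrix (fun _ : EuclideanSpace ℝ (Fin N) => (0 : EuclideanSpace ℝ (Fin N))) x
        = 0 := fun x => by ext i k; simp [gradMatrix]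
    rw [himg, ← e2] at e1
    simp only [hgz, add_zero] at e1
    have p1 : ∀ x, 0 < (s • (1 : Matrix (Fin N) (Fin N) ℝ) + F + gradMatrix u x).det := by
      intro x
      rw [add_assoc]
      refine hpos s hs _ fun i k => ?_
      exact (abs_add_le _ _).trans (add_le_add (hR i k) (abs_gradMatrix_le hu x i k))
    have p2 : 0 < (s • (1 : Matrix (Fin N) (Fin N) ℝ) + F).det :=
      hpos s hs _ fun i k => (hR i k).trans (by simp)
    simp only [abs_of_pos (p1 _), abs_of_pos p2] at e1
    simp only [← add_assoc]
    rw [integral_eq_lintegral_of_nonneg_ae (Eventually.of_forall fun x => (p1 x).le)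
      (integrableOn_det_add_gradMatrix hu hfin _).aestronglyMeasurable, e1, lintegral_const,
      ENNReal.toReal_mul, ENNReal.toReal_ofReal p2.le, Measure.restrict_apply_univ, mul_comm]
    rfl
  -- Distinct interpolation nodes beyond both thresholds; the added 1 makes the contraction
  -- inequality strict.
  set s : ℕ → ℝ := fun i => max s₀ (‖T F‖ + K + 1) + i with hs
  obtain ⟨l, hl⟩ := exists_det_eq_sum_det_smul_one_add (N := N) s (fun a b hab => by
    simpa [hs] using hab)
  simp_rw [hl (F + gradMatrix u _)]
  rw [hl F, integral_finsetSum, Finset.mul_sum]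
  · refine Finset.sum_congr rfl fun i _ => ?_
    have hi : (0 : ℝ) ≤ i := Nat.cast_nonneg i
    rw [integral_const_mul, hlarge (s i), mul_left_comm]
    · have := le_max_left s₀ (‖T F‖ + K + 1)
      simp only [hs]; linarith
    · have := le_max_right s₀ (‖T F‖ + K + 1)
      simp only [hs]; linarith
  · intro i _
    simp_rw [← add_assoc]
    exact (integrableOn_det_add_gradMatrix hu hfin _).const_mul _

end NullLagrangian

/-! ### Weak continuity of the determinant -/

section WeakContinuity

variable {N : ℕ}

/-- Averaging over Q permits differentiation along every line: a single line may lie in the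
exceptional null set of Rademacher's theorem, but its translates by almost all z in Q cause no
trouble at a given s. -/
theorem LipschitzWith.hasDerivAt_setIntegral_translate {E : Type*} [NormedAddCommGroup E]
    [NormedSpace ℝ E] [FiniteDimensional ℝ E] [MeasurableSpace E] [BorelSpace E]
    {μ : Measure E} [μ.IsAddHaarMeasure] {f : E → ℝ} {K : NNReal} (hf : LipschitzWith K f)
    {Q : Set E} (hQ : μ Q ≠ ⊤) (hQb : Bornology.IsBounded Q) (hQm : MeasurableSet Q) (x₀ e : E)
    (s : ℝ) :
    HasDerivAt (fun s : ℝ => ∫ z in Q, f (x₀ + s • e + z) ∂μ)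
      (∫ z in Q, fderiv ℝ f (x₀ + s • e + z) e ∂μ) s := by
  have : IsFiniteMeasure (μ.restrict Q) := ⟨by simpa using hQ.lt_top⟩
  have hcont : ∀ s : ℝ, Continuous fun z => f (x₀ + s • e + z) := fun s =>
    hf.continuous.comp (by fun_prop)
  obtain ⟨M, hM⟩ := hQb.exists_norm_le
  refine (hasDerivAt_integral_of_dominated_loc_of_lip (bound := fun _ => K * ‖e‖)
    (s := Set.univ) univ_mem (Eventually.of_forall fun s => (hcont s).aestronglyMeasurable) ?_
    ?_ ?_ (integrable_const _) ?_).2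
  · refine Integrable.of_bound (C := |f (x₀ + s • e)| + K * M) (hcont s).aestronglyMeasurable ?_
    refine (ae_restrict_iff' hQm).2 (Eventually.of_forall fun z hz => ?_)
    have h1 := hf.norm_sub_le (x₀ + s • e + z) (x₀ + s • e)
    rw [add_sub_cancel_left] at h1
    have h2 : (K : ℝ) * ‖z‖ ≤ K * M := mul_le_mul_of_nonneg_left (hM z hz) K.2
    have h3 := norm_sub_norm_le (f (x₀ + s • e + z)) (f (x₀ + s • e))
    rw [Real.norm_eq_abs (f (x₀ + s • e))] at h3
    linarith
  · exact ((measurable_fderiv_apply_const ℝ f e).comp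
      (by fun_prop : Continuous fun z => x₀ + s • e + z).measurable).aestronglyMeasurable
  · refine Eventually.of_forall fun z => LipschitzOnWith.of_dist_le_mul fun a _ b _ => ?_
    rw [Real.coe_nnabs, abs_of_nonneg (by positivity)]
    refine (hf.dist_le_mul _ _).trans (le_of_eq ?_)
    rw [dist_add_right, dist_add_left, dist_eq_norm, ← sub_smul, norm_smul, dist_eq_norm]
    ring
  · have h1 : ∀ᵐ z ∂μ, DifferentiableAt ℝ f (x₀ + s • e + z) :=
      (quasiMeasurePreserving_add_left μ (x₀ + s • e)).ae hf.ae_differentiableAt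
    refine ae_restrict_of_ae (h1.mono fun z hz => ?_)
    have h2 : HasDerivAt (fun s : ℝ => x₀ + s • e + z) e s := by
      simpa using (((hasDerivAt_id s).smul_const e).const_add x₀).add_const z
    exact hz.hasFDerivAt.comp_hasDerivAt s h2

/-- If the directional derivatives of uniformly Lipschitz functions tend to zero in mean on every
small ball, then the increments in that direction tend to zero. -/
theorem tendsto_sub_of_tendsto_setIntegral_fderiv {E : Type*} [NormedAddCommGroup E]
    [NormedSpace ℝ E] [FiniteDimensional ℝ E] [MeasurableSpace E] [BorelSpace E]
    {μ : Measure E} [μ.IsAddHaarMeasure] {f : ℕ → E → ℝ} {K : NNReal}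
    (hf : ∀ k, LipschitzWith K (f k)) {x₀ y : E} {ρ : ℝ} (hy : y ∈ Metric.ball x₀ ρ)
    (h : ∀ x σ, Metric.ball x σ ⊆ Metric.ball x₀ ρ →
      Tendsto (fun k => ∫ z in Metric.ball x σ, fderiv ℝ (f k) z (y - x₀) ∂μ) atTop (𝓝 0)) :
    Tendsto (fun k => f k y - f k x₀) atTop (𝓝 0) := by
  rw [Metric.tendsto_atTop']
  intro ε hε
  set e := y - x₀ with he
  have hnorm : ‖e‖ < ρ := by rwa [Metric.mem_ball, dist_eq_norm] at hy
  -- The radius keeps the balls centred on the segment inside the large ball, and makes the error of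
  -- replacing the two endpoint values by means, Kσ each, less than ε/2.
  obtain ⟨σ, hσ, hσ1, hσ2⟩ : ∃ σ : ℝ, 0 < σ ∧ σ + ‖e‖ ≤ ρ ∧ 2 * (K * σ) < ε / 2 := by
    refine ⟨min (ρ - ‖e‖) (ε / (8 * (K + 1))), lt_min (by linarith) (by positivity), ?_, ?_⟩
    · have := min_le_left (ρ - ‖e‖) (ε / (8 * (K + 1))); linarith
    · have h1 := min_le_right (ρ - ‖e‖) (ε / (8 * ((K : ℝ) + 1)))
      rw [le_div_iff₀ (by positivity)] at h1
      have h2 : 0 < min (ρ - ‖e‖) (ε / (8 * ((K : ℝ) + 1))) :=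
        lt_min (by linarith) (by positivity)
      nlinarith
  set Q := Metric.ball (0 : E) σ with hQ
  have hQfin : μ Q ≠ ⊤ := measure_ball_lt_top.ne
  have : IsFiniteMeasure (μ.restrict Q) := ⟨by simpa using hQfin.lt_top⟩
  have hV : 0 < μ.real Q := ENNReal.toReal_pos (Metric.measure_ball_pos μ _ hσ).ne' hQfin
  set a : ℕ → ℝ → ℝ := fun k s => ∫ z in Q, f k (x₀ + s • e + z) ∂μ with ha
  set a' : ℕ → ℝ → ℝ := fun k s => ∫ z in Q, fderiv ℝ (f k) (x₀ + s • e + z) e ∂μ with ha'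
  have hder : ∀ k s, HasDerivAt (a k) (a' k s) s := fun k s =>
    (hf k).hasDerivAt_setIntegral_translate hQfin Metric.isBounded_ball measurableSet_ball x₀ e s
  have hbound : ∀ k s, ‖a' k s‖ ≤ (K * ‖e‖) * μ.real Q := fun k s =>
    norm_setIntegral_le_of_norm_le_const hQfin.lt_top fun z _ =>
      ((fderiv ℝ (f k) _).le_opNorm e).trans
        (mul_le_mul_of_nonneg_right (norm_fderiv_le_of_lipschitz ℝ (hf k)) (norm_nonneg _))
  have hmeas : ∀ k, Measurable (a' k) := fun k => by
    have : a' k = deriv (a k) := funext fun s => (hder k s).deriv.symm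
    rw [this]; exact measurable_deriv _
  have hlim : ∀ s ∈ Set.uIoc (0 : ℝ) 1, Tendsto (fun k => a' k s) atTop (𝓝 0) := by
    intro s hs
    rw [Set.uIoc_of_le zero_le_one] at hs
    have h1 : ∀ k, a' k s = ∫ z in Metric.ball (x₀ + s • e) σ, fderiv ℝ (f k) z e ∂μ := by
      intro k
      have h2 := (measurePreserving_add_left μ (x₀ + s • e)).setIntegral_preimage_emb
        (measurableEmbedding_addLeft (x₀ + s • e)) (fun z => fderiv ℝ (f k) z e)
        (Metric.ball (x₀ + s • e) σ)
      rw [← h2]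
      simp [ha', hQ]
    simp_rw [h1]
    refine h _ _ fun z hz => ?_
    rw [Metric.mem_ball] at hz ⊢
    have h3 : dist (x₀ + s • e) x₀ ≤ ‖e‖ := by
      rw [dist_eq_norm, add_sub_cancel_left, norm_smul, Real.norm_of_nonneg hs.1.le]
      exact mul_le_of_le_one_left (norm_nonneg _) hs.2
    linarith [dist_triangle z (x₀ + s • e) x₀]
  -- The increment of the means from x₀ to y is the integral of their derivatives along the segment,
  -- which tends to zero by dominated convergence.
  have hint : Tendsto (fun k => ∫ s in (0 : ℝ)..1, a' k s) atTop (𝓝 0) := by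
    have := intervalIntegral.tendsto_integral_filter_of_dominated_convergence (μ := volume)
      (a := 0) (b := 1) (F := a') (f := fun _ => (0 : ℝ)) (l := atTop)
      (fun _ => (K * ‖e‖) * μ.real Q)
      (Eventually.of_forall fun k => (hmeas k).aestronglyMeasurable)
      (Eventually.of_forall fun k => Eventually.of_forall fun s _ => hbound k s)
      intervalIntegrable_const (Eventually.of_forall hlim)
    simpa using this
  have hftc : ∀ k, ∫ s in (0 : ℝ)..1, a' k s = a k 1 - a k 0 := fun k =>
    intervalIntegral.integral_eq_sub_of_hasDerivAt (fun s _ => hder k s)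
      ((intervalIntegrable_const (c := (K * ‖e‖) * μ.real Q)).mono_fun
        (hmeas k).aestronglyMeasurable (Eventually.of_forall fun s =>
          (hbound k s).trans (le_abs_self _)))
  simp_rw [hftc] at hint
  have hend : ∀ k s, |a k s - μ.real Q * f k (x₀ + s • e)| ≤ (K * σ) * μ.real Q := by
    intro k s
    have hcont : Continuous fun z => f k (x₀ + s • e + z) := (hf k).continuous.comp (by fun_prop)
    have hb : ∀ z ∈ Q, ‖f k (x₀ + s • e + z) - f k (x₀ + s • e)‖ ≤ K * σ := fun z hz => by
      have h1 := (hf k).norm_sub_le (x₀ + s • e + z) (x₀ + s • e)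
      rw [add_sub_cancel_left] at h1
      exact h1.trans (mul_le_mul_of_nonneg_left (mem_ball_zero_iff.1 hz).le K.2)
    have h2 : a k s - μ.real Q * f k (x₀ + s • e)
        = ∫ z in Q, (f k (x₀ + s • e + z) - f k (x₀ + s • e)) ∂μ := by
      have hi : IntegrableOn (fun z => f k (x₀ + s • e + z) - f k (x₀ + s • e)) Q μ :=
        Integrable.of_bound (C := K * σ) (hcont.sub continuous_const).aestronglyMeasurable
          ((ae_restrict_iff' measurableSet_ball).2 (Eventually.of_forall hb))
      have h3 : a k s = ∫ z in Q, ((f k (x₀ + s • e + z) - f k (x₀ + s • e))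
          + f k (x₀ + s • e)) ∂μ := by simp [ha]
      rw [h3, integral_add hi (integrable_const _)]
      simp
    rw [h2, ← Real.norm_eq_abs]
    exact norm_setIntegral_le_of_norm_le_const hQfin.lt_top hb
  obtain ⟨n, hn⟩ := Metric.tendsto_atTop'.1 hint (μ.real Q * (ε / 2)) (by positivity)
  refine ⟨n, fun k hk => ?_⟩
  have h1 := hn k hk
  rw [Real.dist_eq, sub_zero] at h1 ⊢
  have h2 := hend k 0
  have h3 := hend k 1
  have hx : x₀ + (1 : ℝ) • e = y := by simp [he]
  rw [hx] at h3
  rw [zero_smul, add_zero] at h2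
  rw [abs_lt] at h1 ⊢
  rw [abs_le] at h2 h3
  constructor <;> nlinarith

/-- Weak continuity of the determinant, along uniformly Lipschitz maps whose gradients converge
weakly to a constant matrix. -/
theorem tendsto_setIntegral_det_gradMatrix
    {u : ℕ → EuclideanSpace ℝ (Fin N) → EuclideanSpace ℝ (Fin N)} {K : NNReal}
    (hu : ∀ k, LipschitzWith K (u k)) {F : Matrix (Fin N) (Fin N) ℝ}
    {x₀ : EuclideanSpace ℝ (Fin N)} {ρ : ℝ}
    (h : ∀ x σ, Metric.ball x σ ⊆ Metric.ball x₀ ρ → ∀ i j,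
      Tendsto (fun k => ∫ z in Metric.ball x σ, gradMatrix (u k) z i j) atTop
        (𝓝 (volume.real (Metric.ball x σ) * F i j))) :
    Tendsto (fun k => ∫ x in Metric.ball x₀ ρ, (gradMatrix (u k) x).det) atTop
      (𝓝 (volume.real (Metric.ball x₀ ρ) * F.det)) := by
  set T := Matrix.toEuclideanCLM (n := Fin N) (𝕜 := ℝ) with hT
  obtain ⟨v, hv⟩ : ∃ v : ℕ → EuclideanSpace ℝ (Fin N) → EuclideanSpace ℝ (Fin N),
    v = fun k x => u k x - T F x := ⟨_, rfl⟩
  obtain ⟨L, hL⟩ : ∃ L, L = K + ‖T F‖₊ := ⟨_, rfl⟩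
  have hvL : ∀ k, LipschitzWith L (v k) := fun k => by
    rw [hL, hv]; exact (hu k).sub (T F).lipschitz
  have hvi : ∀ k i, LipschitzWith L fun x => v k x i := fun k i => by
    have := (LipschitzWith.of_dist_le_mul (K := 1) (f := fun x : EuclideanSpace ℝ (Fin N) => x i)
      fun a b => by
        rw [NNReal.coe_one, one_mul, dist_eq_norm, dist_eq_norm]
        exact PiLp.norm_apply_le (a - b) i).comp (hvL k)
    rwa [one_mul] at this
  have hfd : ∀ k i (e x : EuclideanSpace ℝ (Fin N)), DifferentiableAt ℝ (u k) x →
      fderiv ℝ (fun x => v k x i) x e = ∑ j, (gradMatrix (u k) x i j - F i j) * e j := by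
    intro k i e x hx
    have h1 : HasFDerivAt (v k) (T (gradMatrix (u k) x - F)) x := by
      rw [map_sub, hv]
      exact (hasFDerivAt_gradMatrix hx).sub (T F).hasFDerivAt
    have h2 := (EuclideanSpace.proj (𝕜 := ℝ) i).hasFDerivAt.comp x h1
    have h3 : fderiv ℝ (fun x => v k x i) x
        = (EuclideanSpace.proj (𝕜 := ℝ) i).comp (T (gradMatrix (u k) x - F)) := h2.fderiv
    rw [h3]
    simp [hT, Matrix.mulVec, dotProduct, sub_mul, Finset.sum_sub_distrib]
  have hpt : ∀ y ∈ Metric.ball x₀ ρ, ∀ i, Tendsto (fun k => v k y i - v k x₀ i) atTop (𝓝 0) := by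
    intro y hy i
    refine tendsto_sub_of_tendsto_setIntegral_fderiv (μ := volume) (fun k => hvi k i) hy ?_
    intro x σ hσ
    have hfin : volume (Metric.ball x σ) ≠ ⊤ := measure_ball_lt_top.ne
    have : IsFiniteMeasure (volume.restrict (Metric.ball x σ)) := ⟨by simpa using hfin.lt_top⟩
    have hint : ∀ k j, IntegrableOn (fun z => gradMatrix (u k) z i j) (Metric.ball x σ) :=
      fun k j => Integrable.of_bound (C := K)
        ((by fun_prop : Continuous fun A : Matrix (Fin N) (Fin N) ℝ => A i j).measurable.comp
          (measurable_gradMatrix (u k))).aestronglyMeasurable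
        (Eventually.of_forall fun z => abs_gradMatrix_le (hu k) z i j)
    have h1 : ∀ k, ∫ z in Metric.ball x σ, fderiv ℝ (fun x => v k x i) z (y - x₀)
        = ∑ j, ((∫ z in Metric.ball x σ, gradMatrix (u k) z i j)
            - volume.real (Metric.ball x σ) * F i j) * (y - x₀) j := by
      intro k
      rw [integral_congr_ae (ae_restrict_of_ae
        ((hu k).ae_differentiableAt.mono fun z hz => hfd k i (y - x₀) z hz)), integral_finsetSum]
      · refine Finset.sum_congr rfl fun j _ => ?_
        rw [integral_mul_const, integral_sub (hint k j) (integrable_const _)]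
        simp
      · intro j _
        exact ((hint k j).sub (integrable_const _)).mul_const _
    simp_rw [h1]
    have h2 : Tendsto (fun k => ∑ j, ((∫ z in Metric.ball x σ, gradMatrix (u k) z i j)
            - volume.real (Metric.ball x σ) * F i j) * (y - x₀) j) atTop
        (𝓝 (∑ j, (volume.real (Metric.ball x σ) * F i j
            - volume.real (Metric.ball x σ) * F i j) * (y - x₀) j)) :=
      tendsto_finsetSum _ fun j _ => ((h x σ hσ i j).sub_const _).mul_const _
    simpa using h2
  set B := Metric.ball x₀ ρ with hB
  have hBfin : volume B ≠ ⊤ := measure_ball_lt_top.ne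
  have : IsFiniteMeasure (volume.restrict B) := ⟨by simpa using hBfin.lt_top⟩
  -- The ball fills the space only when N = 0. There the distance to the empty complement is 0 by
  -- convention, so the truncation below is useless, but the determinant is constantly 1.
  by_cases hBc : (Bᶜ).Nonempty
  swap
  · have hBu : B = Set.univ := by rwa [Set.not_nonempty_iff_eq_empty, Set.compl_empty_iff] at hBc
    have hsub : Subsingleton (EuclideanSpace ℝ (Fin N)) := by
      by_contra hne
      rw [not_subsingleton_iff_nontrivial] at hne
      exact NormedSpace.unbounded_univ ℝ (EuclideanSpace ℝ (Fin N)) (hBu ▸ Metric.isBounded_ball)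
    have hN : IsEmpty (Fin N) := by
      by_contra hne
      rw [not_isEmpty_iff] at hne
      obtain ⟨i⟩ := hne
      have := congrArg (fun x : EuclideanSpace ℝ (Fin N) => x i)
        (Subsingleton.elim (EuclideanSpace.single i (1 : ℝ)) 0)
      simp at this
    simp [Matrix.det_isEmpty]
  obtain ⟨η, hη⟩ : ∃ η : EuclideanSpace ℝ (Fin N) → ℝ, η = fun x => Metric.infDist x Bᶜ :=
    ⟨_, rfl⟩
  have hηL : LipschitzWith 1 η := hη ▸ Metric.lipschitz_infDist_pt _
  have hηpos : ∀ x ∈ B, 0 < η x := fun x hx => by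
    rw [hη]
    exact (Metric.isOpen_ball.isClosed_compl.notMem_iff_infDist_pos hBc).1 (not_not.2 hx)
  have hηz : ∀ x, x ∉ B → η x = 0 := fun x hx => by
    rw [hη]; exact Metric.infDist_zero_of_mem hx
  -- Each component of v k − v k x₀ is clipped to [−η, η], with η the distance to the complement of
  -- B. This forces zero boundary values at no cost in the uniform Lipschitz bound. Pointwise
  -- convergence suffices: η > 0 at each point of B, so the clipping is eventually inactive near
  -- that point.
  obtain ⟨w, hw⟩ : ∃ w : ℕ → EuclideanSpace ℝ (Fin N) → EuclideanSpace ℝ (Fin N),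
    w = fun k x => WithLp.toLp 2 fun i => max (-η x) (min (v k x i - v k x₀ i) (η x)) := ⟨_, rfl⟩
  obtain ⟨M, hwM⟩ : ∃ M : NNReal, ∀ k, LipschitzWith M (w k) := by
    obtain ⟨c, hc⟩ : ∃ c, LipschitzWith c
        (WithLp.toLp 2 : (Fin N → ℝ) → EuclideanSpace ℝ (Fin N)) :=
      ⟨_, PiLp.lipschitzWith_toLp 2 (fun _ : Fin N => ℝ)⟩
    refine ⟨c * max 1 L, fun k => ?_⟩
    rw [hw]
    refine hc.comp (LipschitzWith.of_dist_le_mul (K := max 1 L) fun a b => ?_)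
    refine (dist_pi_le_iff (by positivity)).2 fun i => ?_
    have h1 : LipschitzWith (max 1 (max (L + 0) 1))
        fun x => max (-η x) (min (v k x i - v k x₀ i) (η x)) :=
      hηL.neg.max (((hvi k i).sub (LipschitzWith.const _)).min hηL)
    rw [add_zero, max_comm L, ← max_assoc, max_self] at h1
    exact h1.dist_le_mul a b
  have hw0 : ∀ k x, x ∉ B → w k x = 0 := by
    intro k x hx
    ext i
    simp only [hw, hηz x hx, neg_zero, PiLp.zero_apply]
    exact max_eq_left (min_le_right _ _)
  have hgrad : ∀ᵐ x, ∀ k, DifferentiableAt ℝ (u k) x :=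
    ae_all_iff.2 fun k => (hu k).ae_differentiableAt
  have hev : ∀ᵐ x ∂(volume.restrict B), ∀ᶠ k in atTop,
      F + gradMatrix (w k) x = gradMatrix (u k) x := by
    refine (ae_restrict_iff' measurableSet_ball).2 (hgrad.mono fun x hx hxB => ?_)
    have h1 : ∀ᶠ k in atTop, ∀ i, |v k x i - v k x₀ i| < η x := by
      rw [eventually_all]
      intro i
      have h2 := (hpt x hxB i).abs
      rw [abs_zero] at h2
      exact h2.eventually (gt_mem_nhds (hηpos x hxB))
    filter_upwards [h1] with k hk
    have h3 : ∀ᶠ z in 𝓝 x, ∀ i, |v k z i - v k x₀ i| < η z := by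
      rw [eventually_all]
      intro i
      exact (((hvi k i).continuous.sub continuous_const).abs).continuousAt.eventually_lt
        hηL.continuous.continuousAt (hk i)
    have h4 : w k =ᶠ[𝓝 x] fun z => v k z - v k x₀ := by
      filter_upwards [h3] with z hz
      ext i
      have h5 := abs_lt.1 (hz i)
      simp only [hw, PiLp.sub_apply]
      rw [min_eq_left h5.2.le, max_eq_right h5.1.le]
    have h6 : HasFDerivAt (fun z => v k z - v k x₀) (T (gradMatrix (u k) x - F)) x := by
      rw [map_sub, hv]
      exact ((hasFDerivAt_gradMatrix (hx k)).sub (T F).hasFDerivAt).sub_const _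
    rw [gradMatrix_eq_of_hasFDerivAt (h6.congr_of_eventuallyEq h4), add_sub_cancel]
  have hcont : Continuous fun A : Matrix (Fin N) (Fin N) ℝ => A.det := by fun_prop
  have hcontF : Continuous fun A : Matrix (Fin N) (Fin N) ℝ => (F + A).det := by fun_prop
  obtain ⟨C₁, -, hC₁⟩ := hcont.exists_abs_le_of_entries_le K
  obtain ⟨C₂, -, hC₂⟩ := hcontF.exists_abs_le_of_entries_le M
  have hi1 : ∀ k, IntegrableOn (fun x => (gradMatrix (u k) x).det) B := fun k => by
    simpa using integrableOn_det_add_gradMatrix (hu k) hBfin 0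
  have hi2 : ∀ k, IntegrableOn (fun x => (F + gradMatrix (w k) x).det) B := fun k =>
    integrableOn_det_add_gradMatrix (hwM k) hBfin F
  have hlim : Tendsto (fun k => ∫ x in B, ((gradMatrix (u k) x).det
      - (F + gradMatrix (w k) x).det)) atTop (𝓝 (∫ x in B, (0 : ℝ))) := by
    refine tendsto_integral_of_dominated_convergence (fun _ => C₁ + C₂)
      (fun k => ((hi1 k).sub (hi2 k)).aestronglyMeasurable) (integrable_const _) ?_ ?_
    · refine fun k => Eventually.of_forall fun x => (norm_sub_le _ _).trans (add_le_add ?_ ?_)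
      · exact hC₁ _ (abs_gradMatrix_le (hu k) x)
      · exact hC₂ _ (abs_gradMatrix_le (hwM k) x)
    · refine hev.mono fun x hx => tendsto_const_nhds.congr' ?_
      filter_upwards [hx] with k hk
      rw [hk, sub_self]
  have heq : ∀ k, ∫ x in B, ((gradMatrix (u k) x).det - (F + gradMatrix (w k) x).det)
      = (∫ x in B, (gradMatrix (u k) x).det) - volume.real B * F.det := fun k => by
    rw [integral_sub (hi1 k) (hi2 k),
      integral_det_add_gradMatrix (hwM k) measurableSet_ball hBfin (hw0 k)]
  simp_rw [heq] at hlim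
  rw [integral_zero] at hlim
  simpa using hlim.add_const (volume.real B * F.det)

/-- The determinant commutes with homogeneous gradient Young measures. -/
theorem IsHomogeneousGradientYoungMeasure.integral_det {Ω : Set (EuclideanSpace ℝ (Fin N))}
    (hΩ : IsOpen Ω) (hne : Ω.Nonempty) {ν : Measure (Matrix (Fin N) (Fin N) ℝ)}
    (hν : IsHomogeneousGradientYoungMeasure Ω ν) :
    ∫ A, A.det ∂ν = (matrixBarycenter ν).det := by
  obtain ⟨-, u, K, C, hK, -, hψ⟩ := hν
  -- The Lipschitz extension has a constant independent of k, and has the same gradient on the open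
  -- set Ω.
  choose U hU hUu using fun k => (hK k).extend_finite_dimension
  obtain ⟨x₀, hx₀⟩ := hne
  obtain ⟨ρ, hρ, hball⟩ := Metric.isOpen_iff.1 hΩ x₀ hx₀
  have hgrad : ∀ k, ∀ x ∈ Ω, gradMatrix (U k) x = gradMatrix (u k) x := by
    intro k x hx
    have : U k =ᶠ[𝓝 x] u k := by
      filter_upwards [hΩ.mem_nhds hx] with z hz using (hUu k hz).symm
    ext i j
    simp [gradMatrix, this.fderiv_eq]
  have hlim : ∀ x σ, Metric.ball x σ ⊆ Metric.ball x₀ ρ → ∀ ψ : Matrix (Fin N) (Fin N) ℝ → ℝ,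
      Continuous ψ → Tendsto (fun k => ∫ z in Metric.ball x σ, ψ (gradMatrix (U k) z)) atTop
        (𝓝 (volume.real (Metric.ball x σ) * ∫ A, ψ A ∂ν)) := by
    intro x σ hσ ψ hc
    have hsub : Metric.ball x σ ⊆ Ω := hσ.trans hball
    -- Indicators of balls as test functions localise the weak-* convergence.
    have hg : IntegrableOn ((Metric.ball x σ).indicator fun _ => (1 : ℝ)) Ω :=
      ((integrable_indicator_iff measurableSet_ball).2
        (integrableOn_const measure_ball_lt_top.ne)).integrableOn
    have h1 := hψ ψ hc _ hg
    have h3 : ∫ z in Ω, (Metric.ball x σ).indicator (fun _ => (1 : ℝ)) z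
        = volume.real (Metric.ball x σ) := by
      rw [setIntegral_indicator measurableSet_ball, Set.inter_eq_right.2 hsub]
      simp
    rw [h3] at h1
    refine h1.congr fun k => ?_
    have h4 : ∀ z, (Metric.ball x σ).indicator (fun _ => (1 : ℝ)) z * ψ (gradMatrix (u k) z)
        = (Metric.ball x σ).indicator (fun z => ψ (gradMatrix (u k) z)) z := by
      intro z
      by_cases hz : z ∈ Metric.ball x σ
      · rw [Set.indicator_of_mem hz, Set.indicator_of_mem hz, one_mul]
      · rw [Set.indicator_of_notMem hz, Set.indicator_of_notMem hz, zero_mul]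
    simp_rw [h4]
    rw [setIntegral_indicator measurableSet_ball, Set.inter_eq_right.2 hsub]
    exact setIntegral_congr_fun measurableSet_ball fun z hz => by
      simp only [hgrad k z (hsub hz)]
  have h1 := tendsto_setIntegral_det_gradMatrix (F := matrixBarycenter ν) hU
    (fun x σ hσ i j => hlim x σ hσ (fun A => A i j) (by fun_prop))
  have h2 := hlim x₀ ρ subset_rfl (fun A => A.det) (by fun_prop)
  have hpos : volume.real (Metric.ball x₀ ρ) ≠ 0 :=
    (ENNReal.toReal_pos (Metric.measure_ball_pos volume _ hρ).ne' measure_ball_lt_top.ne).ne'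
  exact mul_left_cancel₀ hpos (tendsto_nhds_unique h2 h1)

end WeakContinuity

/-! ### Fine layers and oscillating functions -/

section Oscillation

/-- Translations act continuously on integrable functions. -/
theorem MeasureTheory.Integrable.tendsto_integral_norm_translate_sub {E : Type*}
    [NormedAddCommGroup E] [NormedSpace ℝ E] [FiniteDimensional ℝ E] [MeasurableSpace E]
    [BorelSpace E] {μ : Measure E} [μ.IsAddHaarMeasure] {g : E → ℝ} (hg : Integrable g μ) :
    Tendsto (fun τ : E => ∫ x, ‖g (τ + x) - g x‖ ∂μ) (𝓝 0) (𝓝 0) := by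
  have hg1 : MemLp g 1 μ := memLp_one_iff_integrable.2 hg
  have : Fact ((1 : ENNReal) ≠ ⊤) := ⟨ENNReal.one_ne_top⟩
  have hc : Continuous fun τ : E => ‖(DomAddAct.mk τ +ᵥ hg1.toLp g) - hg1.toLp g‖ := by
    refine (Continuous.sub ?_ continuous_const).norm
    exact Continuous.vadd (DomAddAct.continuous_mk (M := E)) continuous_const
  have h0 := hc.tendsto 0
  have hval : ∀ τ : E, ‖(DomAddAct.mk τ +ᵥ hg1.toLp g) - hg1.toLp g‖
      = ∫ x, ‖g (τ + x) - g x‖ ∂μ := by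
    intro τ
    rw [DomAddAct.mk_vadd_toLp, ← MemLp.toLp_sub, L1.norm_eq_integral_norm]
    refine integral_congr_ae ?_
    filter_upwards [MemLp.coeFn_toLp ((hg1.comp_measurePreserving
      (measurePreserving_vadd τ μ)).sub hg1)] with x hx
    exact congrArg (fun r : ℝ => ‖r‖) hx
  simp_rw [hval] at h0
  simpa using h0

/-- A nonzero linear functional pushes Haar measure forward to a multiple of Lebesgue measure on the
line. This is used to discard the interfaces between layers. -/
theorem measure_preimage_countable_eq_zero {E : Type*} [NormedAddCommGroup E] [NormedSpace ℝ E]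
    [FiniteDimensional ℝ E] [MeasurableSpace E] [BorelSpace E] {μ : Measure E}
    [μ.IsAddHaarMeasure] {l : E →L[ℝ] ℝ} (hl : l ≠ 0) {S : Set ℝ} (hS : S.Countable) :
    μ (l ⁻¹' S) = 0 := by
  have hsurj : Function.Surjective (l : E →ₗ[ℝ] ℝ) :=
    LinearMap.surjective (fun h => hl (ContinuousLinearMap.coe_injective h))
  obtain ⟨c, -, -, hmap⟩ :=
    LinearMap.exists_map_addHaar_eq_smul_addHaar' (l : E →ₗ[ℝ] ℝ) μ volume hsurj
  have h1 : (μ.map l) S = 0 := by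
    change (μ.map (l : E →ₗ[ℝ] ℝ)) S = 0
    rw [hmap]
    simp [hS.measure_zero]
  rwa [Measure.map_apply l.continuous.measurable hS.measurableSet] at h1

theorem countable_setOf_fract_mul_mem {k : ℝ} (hk : k ≠ 0) :
    {t : ℝ | Int.fract (k * t) = 0 ∨ Int.fract (k * t) = 1 / 2}.Countable := by
  refine (Set.countable_range fun m : ℤ => (m : ℝ) / (2 * k)).mono ?_
  rintro t (h | h)
  · refine ⟨2 * ⌊k * t⌋, ?_⟩
    have := Int.floor_add_fract (k * t)
    rw [h] at this
    push_cast
    field_simp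
    linarith
  · refine ⟨2 * ⌊k * t⌋ + 1, ?_⟩
    have := Int.floor_add_fract (k * t)
    rw [h] at this
    push_cast
    field_simp
    linarith

theorem fract_sub_half_mem_iff (s : ℝ) :
    Int.fract (s - 1 / 2) ∈ Set.Ioo (0 : ℝ) (1 / 2) ↔ Int.fract s ∈ Set.Ioo (1 / 2 : ℝ) 1 := by
  have h1 := Int.fract_nonneg s
  have h2 := Int.fract_lt_one s
  have h3 := Int.floor_add_fract s
  by_cases h : 1 / 2 ≤ Int.fract s
  · have : Int.fract (s - 1 / 2) = Int.fract s - 1 / 2 :=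
      Int.fract_eq_iff.2 ⟨by linarith, by linarith, ⌊s⌋, by linarith⟩
    rw [this, Set.mem_Ioo, Set.mem_Ioo]
    constructor <;> rintro ⟨h4, h5⟩ <;> constructor <;> linarith
  · push Not at h
    have : Int.fract (s - 1 / 2) = Int.fract s + 1 / 2 :=
      Int.fract_eq_iff.2 ⟨by linarith, by linarith, ⌊s⌋ - 1, by push_cast; linarith⟩
    rw [this, Set.mem_Ioo, Set.mem_Ioo]
    constructor <;> rintro ⟨h4, h5⟩ <;> linarith

theorem hasDerivAt_abs_sub_round_of_fract_lt {s : ℝ} (h : Int.fract s ∈ Set.Ioo (0 : ℝ) (1 / 2)) :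
    HasDerivAt (fun t : ℝ => |t - round t|) 1 s := by
  have h3 := Int.floor_add_fract s
  have hmem : Set.Ioo (⌊s⌋ : ℝ) (⌊s⌋ + 1 / 2) ∈ 𝓝 s :=
    Ioo_mem_nhds (by linarith [h.1]) (by linarith [h.2])
  refine ((hasDerivAt_id s).sub_const (⌊s⌋ : ℝ)).congr_of_eventuallyEq ?_
  filter_upwards [hmem] with t ht
  have hf : Int.fract t = t - ⌊s⌋ :=
    Int.fract_eq_iff.2 ⟨by linarith [ht.1], by linarith [ht.2], ⌊s⌋, by ring⟩
  rw [abs_sub_round_eq_min, hf, min_eq_left (by linarith [ht.2])]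
  rfl

theorem hasDerivAt_abs_sub_round_of_lt_fract {s : ℝ} (h : Int.fract s ∈ Set.Ioo (1 / 2 : ℝ) 1) :
    HasDerivAt (fun t : ℝ => |t - round t|) (-1) s := by
  have h3 := Int.floor_add_fract s
  have hmem : Set.Ioo (⌊s⌋ + 1 / 2 : ℝ) (⌊s⌋ + 1) ∈ 𝓝 s :=
    Ioo_mem_nhds (by linarith [h.1]) (by linarith [h.2])
  refine ((hasDerivAt_id s).const_sub (⌊s⌋ + 1 : ℝ)).congr_of_eventuallyEq ?_
  filter_upwards [hmem] with t ht
  have hf : Int.fract t = t - ⌊s⌋ :=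
    Int.fract_eq_iff.2 ⟨by linarith [ht.1], by linarith [ht.2], ⌊s⌋, by ring⟩
  rw [abs_sub_round_eq_min, hf, min_eq_right (by linarith [ht.1])]
  change _ = _ - t
  ring

theorem lipschitzWith_abs_sub_round : LipschitzWith 1 fun t : ℝ => |t - round t| := by
  refine LipschitzWith.of_le_add fun x y => ?_
  calc |x - round x| ≤ |x - round y| := round_le x (round y)
    _ ≤ |x - y| + |y - round y| := abs_sub_le _ _ _
    _ = |y - round y| + dist x y := by rw [Real.dist_eq, add_comm]

variable {E : Type*} [NormedAddCommGroup E] [InnerProductSpace ℝ E] [FiniteDimensional ℝ E]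
  [MeasurableSpace E] [BorelSpace E] {μ : Measure E} [μ.IsAddHaarMeasure]

/-- Fine layers of equal thickness occupy, in the weak sense, half of the space. -/
theorem tendsto_setIntegral_layers {n : E} (hn : n ≠ 0) {g : E → ℝ} (hg : Integrable g μ) :
    Tendsto (fun k : ℕ => ∫ x in {x | Int.fract (((k : ℝ) + 1) * inner ℝ n x)
        ∈ Set.Ioo (0 : ℝ) (1 / 2)}, g x ∂μ) atTop (𝓝 ((∫ x, g x ∂μ) / 2)) ∧
      Tendsto (fun k : ℕ => ∫ x in {x | Int.fract (((k : ℝ) + 1) * inner ℝ n x)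
        ∈ Set.Ioo (1 / 2 : ℝ) 1}, g x ∂μ) atTop (𝓝 ((∫ x, g x ∂μ) / 2)) := by
  set P : ℕ → Set E := fun k => {x | Int.fract (((k : ℝ) + 1) * inner ℝ n x)
    ∈ Set.Ioo (0 : ℝ) (1 / 2)} with hP
  set Q : ℕ → Set E := fun k => {x | Int.fract (((k : ℝ) + 1) * inner ℝ n x)
    ∈ Set.Ioo (1 / 2 : ℝ) 1} with hQ
  have hmeas : ∀ k : ℕ, Measurable fun x : E => Int.fract (((k : ℝ) + 1) * inner ℝ n x) :=
    fun k => Measurable.fract (by fun_prop)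
  have hPm : ∀ k, MeasurableSet (P k) := fun k => hmeas k measurableSet_Ioo
  have hQm : ∀ k, MeasurableSet (Q k) := fun k => hmeas k measurableSet_Ioo
  have hsum : ∀ k, (∫ x in P k, g x ∂μ) + ∫ x in Q k, g x ∂μ = ∫ x, g x ∂μ := by
    intro k
    have hk : ((k : ℝ) + 1) ≠ 0 := by positivity
    have hl : innerSL ℝ n ≠ 0 := fun h => hn (by simpa using congrArg (fun l => l n) h)
    rw [← setIntegral_union ?_ (hQm k) hg.integrableOn hg.integrableOn]
    · rw [← setIntegral_univ (μ := μ)]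
      refine setIntegral_congr_set ?_
      rw [ae_eq_univ]
      refine measure_mono_null ?_ (measure_preimage_countable_eq_zero (μ := μ) hl
        (countable_setOf_fract_mul_mem hk))
      intro x hx
      simp only [hP, hQ, Set.mem_compl_iff, Set.mem_union, Set.mem_ofPred_eq, Set.mem_Ioo,
        not_or, not_and, not_lt] at hx
      simp only [Set.mem_preimage, Set.mem_ofPred_eq, innerSL_apply_apply]
      have h1 := Int.fract_nonneg (((k : ℝ) + 1) * inner ℝ n x)
      have h2 := Int.fract_lt_one (((k : ℝ) + 1) * inner ℝ n x)
      rcases h1.eq_or_lt with h | h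
      · exact Or.inl h.symm
      · refine Or.inr (le_antisymm ?_ (hx.1 h))
        by_contra h3
        push Not at h3
        linarith [hx.2 h3]
    · exact Set.disjoint_left.2 fun x h1 h2 => by
        have h3 := h1.2; have h4 := h2.1; linarith
  have hnn : inner ℝ n n ≠ 0 := inner_self_ne_zero.2 hn
  -- Half a period along n: this translation carries one family of layers onto the other. Since τ k
  -- → 0, continuity of translations in L¹ makes the two integrals asymptotically equal, while their
  -- sum is the full integral.
  set τ : ℕ → E := fun k => (1 / (2 * ((k : ℝ) + 1) * inner ℝ n n)) • n with hτ
  have hshift : ∀ k, ∫ x in Q k, g x ∂μ = ∫ x in P k, g (τ k + x) ∂μ := by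
    intro k
    rw [← (measurePreserving_add_left μ (τ k)).setIntegral_preimage_emb
      (measurableEmbedding_addLeft (τ k)) g (Q k)]
    congr 2
    ext x
    simp only [hP, hQ, Set.mem_preimage, Set.mem_ofPred_eq]
    rw [← fract_sub_half_mem_iff]
    have : ((k : ℝ) + 1) * inner ℝ n (τ k + x) - 1 / 2 = ((k : ℝ) + 1) * inner ℝ n x := by
      have hk : ((k : ℝ) + 1) ≠ 0 := by positivity
      simp only [hτ, inner_add_right, inner_smul_right]
      field_simp
      ring
    rw [this]
  have hτ0 : Tendsto τ atTop (𝓝 0) := by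
    have h1 : Tendsto (fun k : ℕ => 1 / ((k : ℝ) + 1)) atTop (𝓝 0) :=
      tendsto_one_div_add_atTop_nhds_zero_nat
    have h2 := (h1.mul_const (1 / (2 * inner ℝ n n))).smul_const n
    rw [zero_mul, zero_smul] at h2
    refine h2.congr fun k => ?_
    simp only [hτ]
    congr 1
    field_simp
  have hdiff : Tendsto (fun k => (∫ x in Q k, g x ∂μ) - ∫ x in P k, g x ∂μ) atTop (𝓝 0) := by
    refine squeeze_zero_norm (fun k => ?_)
      (hg.tendsto_integral_norm_translate_sub.comp hτ0)
    have hg' : Integrable (fun x => g (τ k + x)) μ := hg.comp_add_left (τ k)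
    rw [hshift, ← integral_sub hg'.integrableOn hg.integrableOn]
    refine (norm_integral_le_integral_norm _).trans ?_
    exact setIntegral_le_integral (hg'.sub hg).norm (Eventually.of_forall fun x => norm_nonneg _)
  have hQ' : ∀ k, ∫ x in Q k, g x ∂μ = (∫ x, g x ∂μ) - ∫ x in P k, g x ∂μ := fun k => by
    rw [← hsum k]; ring
  have hP' : Tendsto (fun k => ∫ x in P k, g x ∂μ) atTop (𝓝 ((∫ x, g x ∂μ) / 2)) := by
    have h1 := (hdiff.const_sub (∫ x, g x ∂μ)).div_const 2
    rw [sub_zero] at h1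
    refine h1.congr fun k => ?_
    rw [hQ' k]; ring
  refine ⟨hP', ?_⟩
  have := hP'.const_sub (∫ x, g x ∂μ)
  rw [sub_half] at this
  exact this.congr fun k => (hQ' k).symm

/-- Oscillating Lipschitz functions with zero boundary values, whose gradient equals `n` on one
half of an open set and `-n` on the other half, in the limit. -/
theorem exists_oscillating_sequence {n : E} (hn : n ≠ 0) {Ω : Set E} (hΩ : IsOpen Ω)
    (hΩc : (Ωᶜ).Nonempty) :
    ∃ (w : ℕ → E → ℝ) (K : NNReal) (A B : ℕ → Set E),
      (∀ k, LipschitzWith K (w k)) ∧ (∀ k x, x ∉ Ω → w k x = 0) ∧ (∀ k x, |w k x| ≤ 1) ∧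
      (∀ k, MeasurableSet (A k)) ∧ (∀ k, MeasurableSet (B k)) ∧
      (∀ k, A k ⊆ Ω) ∧ (∀ k, B k ⊆ Ω) ∧ (∀ k, Disjoint (A k) (B k)) ∧
      (∀ k, ∀ x ∈ A k, HasFDerivAt (w k) (innerSL ℝ n) x) ∧
      (∀ k, ∀ x ∈ B k, HasFDerivAt (w k) (-innerSL ℝ n) x) ∧
      ∀ g : E → ℝ, IntegrableOn g Ω μ →
        Tendsto (fun k => ∫ x in A k, g x ∂μ) atTop (𝓝 ((∫ x in Ω, g x ∂μ) / 2)) ∧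
        Tendsto (fun k => ∫ x in B k, g x ∂μ) atTop (𝓝 ((∫ x in Ω, g x ∂μ) / 2)) := by
  set P : ℕ → Set E := fun k => {x | Int.fract (((k : ℝ) + 1) * inner ℝ n x)
    ∈ Set.Ioo (0 : ℝ) (1 / 2)} with hP
  set Q : ℕ → Set E := fun k => {x | Int.fract (((k : ℝ) + 1) * inner ℝ n x)
    ∈ Set.Ioo (1 / 2 : ℝ) 1} with hQ
  set D : ℕ → Set E := fun k => {x | 1 / ((k : ℝ) + 1) < Metric.infDist x Ωᶜ} with hD
  have hmeas : ∀ k : ℕ, Measurable fun x : E => Int.fract (((k : ℝ) + 1) * inner ℝ n x) :=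
    fun k => Measurable.fract (by fun_prop)
  have hPm : ∀ k, MeasurableSet (P k) := fun k => hmeas k measurableSet_Ioo
  have hQm : ∀ k, MeasurableSet (Q k) := fun k => hmeas k measurableSet_Ioo
  have hDm : ∀ k, MeasurableSet (D k) := fun k =>
    (isOpen_lt continuous_const (Metric.continuous_infDist_pt _)).measurableSet
  have hDΩ : ∀ k, D k ⊆ Ω := fun k x hx => by
    by_contra h
    have h1 : 1 / ((k : ℝ) + 1) < Metric.infDist x Ωᶜ := hx
    rw [Metric.infDist_zero_of_mem h] at h1
    exact absurd h1 (not_lt.2 (by positivity))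
  -- Triangle waves of slope ±n and height at most 1/(2(k+1)). Their minimum with the distance to
  -- the complement of Ω vanishes off Ω and is unaltered on `D k`, which exhausts Ω.
  set tri : ℕ → E → ℝ := fun k x =>
    (1 / ((k : ℝ) + 1)) * |((k : ℝ) + 1) * inner ℝ n x - round (((k : ℝ) + 1) * inner ℝ n x)|
    with htri
  have htri0 : ∀ k x, 0 ≤ tri k x := fun k x => by positivity
  have htri1 : ∀ k x, tri k x ≤ (1 / ((k : ℝ) + 1)) * (1 / 2) := fun k x =>
    mul_le_mul_of_nonneg_left (abs_sub_round _) (by positivity)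
  have htriL : ∀ k, LipschitzWith ‖n‖₊ (tri k) := by
    intro k
    refine LipschitzWith.of_dist_le_mul fun x y => ?_
    have hk : (0 : ℝ) < (k : ℝ) + 1 := by positivity
    have h1 := lipschitzWith_abs_sub_round.dist_le_mul (((k : ℝ) + 1) * inner ℝ n x)
      (((k : ℝ) + 1) * inner ℝ n y)
    rw [Real.dist_eq, Real.dist_eq, ← mul_sub, ← inner_sub_right, abs_mul, abs_of_pos hk,
      NNReal.coe_one, one_mul] at h1
    rw [Real.dist_eq, ← mul_sub, abs_mul, abs_of_pos (by positivity), dist_eq_norm, coe_nnnorm]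
    calc _ ≤ (1 / ((k : ℝ) + 1)) * (((k : ℝ) + 1) * |inner ℝ n (x - y)|) :=
          mul_le_mul_of_nonneg_left h1 (by positivity)
      _ = |inner ℝ n (x - y)| := by field_simp
      _ ≤ _ := abs_real_inner_le_norm _ _
  set w : ℕ → E → ℝ := fun k x => min (tri k x) (Metric.infDist x Ωᶜ) with hw
  have hweq : ∀ k, ∀ x ∈ D k, w k =ᶠ[𝓝 x] tri k := by
    intro k x hx
    have hop : IsOpen (D k) := isOpen_lt continuous_const (Metric.continuous_infDist_pt _)
    filter_upwards [hop.mem_nhds hx] with z hz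
    refine min_eq_left (((htri1 k z).trans ?_).trans (le_of_lt hz))
    have : (0 : ℝ) < 1 / ((k : ℝ) + 1) := by positivity
    linarith
  have htrider : ∀ (k : ℕ) (x : E) (σ : ℝ), HasDerivAt (fun t : ℝ => |t - round t|) σ
      (((k : ℝ) + 1) * inner ℝ n x) → HasFDerivAt (tri k) (σ • innerSL ℝ n) x := by
    intro k x σ h
    have h1 : HasFDerivAt (fun x => ((k : ℝ) + 1) * inner ℝ n x)
        (((k : ℝ) + 1) • innerSL ℝ n) x := (innerSL ℝ n).hasFDerivAt.const_mul _
    have h2 := (h.comp_hasFDerivAt x h1).const_mul (1 / ((k : ℝ) + 1))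
    convert! h2 using 1
    rw [smul_smul, smul_smul]
    congr 1
    field_simp
  refine ⟨w, max ‖n‖₊ 1, fun k => P k ∩ D k, fun k => Q k ∩ D k,
    fun k => (htriL k).min (Metric.lipschitz_infDist_pt _), ?_, ?_,
    fun k => (hPm k).inter (hDm k), fun k => (hQm k).inter (hDm k),
    fun k => Set.inter_subset_right.trans (hDΩ k), fun k => Set.inter_subset_right.trans (hDΩ k),
    ?_, ?_, ?_, ?_⟩
  · intro k x hx
    simp only [hw, Metric.infDist_zero_of_mem (show x ∈ Ωᶜ from hx)]
    exact min_eq_right (htri0 k x)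
  · intro k x
    have h0 : 0 ≤ w k x := le_min (htri0 k x) Metric.infDist_nonneg
    rw [abs_of_nonneg h0]
    refine (min_le_left _ _).trans ((htri1 k x).trans ?_)
    have : 1 / ((k : ℝ) + 1) ≤ 1 := by
      rw [div_le_one (by positivity)]
      linarith [(Nat.cast_nonneg k : (0 : ℝ) ≤ k)]
    linarith
  · refine fun k => Set.disjoint_left.2 fun x h1 h2 => ?_
    have h3 := h1.1.2; have h4 := h2.1.1; linarith
  · intro k x hx
    have := htrider k x 1 (hasDerivAt_abs_sub_round_of_fract_lt hx.1)
    rw [one_smul] at this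
    exact this.congr_of_eventuallyEq (hweq k x hx.2)
  · intro k x hx
    have := htrider k x (-1) (hasDerivAt_abs_sub_round_of_lt_fract hx.1)
    rw [neg_one_smul] at this
    exact this.congr_of_eventuallyEq (hweq k x hx.2)
  · intro g hg
    have hG : Integrable (Ω.indicator g) μ := (integrable_indicator_iff hΩ.measurableSet).2 hg
    have hsmall : Tendsto (fun k : ℕ => ∫ x, (D k)ᶜ.indicator (fun x => |Ω.indicator g x|) x ∂μ)
        atTop (𝓝 0) := by
      have h1 : Tendsto (fun k : ℕ => ∫ x, (D k)ᶜ.indicator (fun x => |Ω.indicator g x|) x ∂μ)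
          atTop (𝓝 (∫ x, (0 : ℝ) ∂μ)) := by
        refine tendsto_integral_of_dominated_convergence (fun x => |Ω.indicator g x|)
          (fun k => (hG.abs.indicator (hDm k).compl).aestronglyMeasurable) hG.abs
          (fun k => Eventually.of_forall fun x => ?_) (Eventually.of_forall fun x => ?_)
        · rw [Real.norm_eq_abs]
          by_cases h : x ∈ (D k)ᶜ
          · rw [Set.indicator_of_mem h, abs_abs]
          · rw [Set.indicator_of_notMem h, abs_zero]; exact abs_nonneg _
        · by_cases hx : x ∈ Ω
          · have hpos : 0 < Metric.infDist x Ωᶜ :=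
              (hΩ.isClosed_compl.notMem_iff_infDist_pos hΩc).1 (not_not.2 hx)
            refine tendsto_const_nhds.congr' ?_
            filter_upwards [tendsto_one_div_add_atTop_nhds_zero_nat.eventually
              (gt_mem_nhds hpos)] with k hk
            rw [Set.indicator_of_notMem]
            exact not_not.2 hk
          · refine tendsto_const_nhds.congr fun k => ?_
            rw [eq_comm, Set.indicator_apply_eq_zero]
            intro _
            rw [Set.indicator_of_notMem hx, abs_zero]
      rwa [integral_zero] at h1
    have hred : ∀ R : ℕ → Set E, (∀ k, MeasurableSet (R k)) →
        Tendsto (fun k => ∫ x in R k, Ω.indicator g x ∂μ) atTop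
          (𝓝 ((∫ x, Ω.indicator g x ∂μ) / 2)) →
        Tendsto (fun k => ∫ x in R k ∩ D k, g x ∂μ) atTop (𝓝 ((∫ x in Ω, g x ∂μ) / 2)) := by
      intro R hR hlim
      rw [integral_indicator hΩ.measurableSet] at hlim
      have h1 : Tendsto (fun k => (∫ x in R k, Ω.indicator g x ∂μ)
          - ∫ x in R k ∩ D k, g x ∂μ) atTop (𝓝 0) := by
        refine squeeze_zero_norm (fun k => ?_) hsmall
        have h2 : ∫ x in R k ∩ D k, g x ∂μ = ∫ x in R k ∩ D k, Ω.indicator g x ∂μ :=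
          setIntegral_congr_fun ((hR k).inter (hDm k)) fun x hx => by
            rw [Set.indicator_of_mem (hDΩ k hx.2)]
        rw [h2, ← integral_inter_add_sdiff (hDm k) hG.integrableOn, add_sub_cancel_left]
        refine (norm_integral_le_integral_norm _).trans ?_
        rw [integral_indicator (hDm k).compl]
        exact setIntegral_mono_set hG.abs.integrableOn
          (Eventually.of_forall fun x => abs_nonneg _)
          (Eventually.of_forall fun x hx => hx.2)
      have h3 := hlim.sub h1
      simpa using h3
    obtain ⟨h1, h2⟩ := tendsto_setIntegral_layers hn hG
    exact ⟨hred P hPm h1, hred Q hQm h2⟩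

end Oscillation

/-! ### Extended-real integrals -/

section ExtIntegral

variable {X : Type*} [MeasurableSpace X] {μ : Measure X}

theorem extIntegral_of_nonneg {f : X → EReal} (h : ∀ x, 0 ≤ f x) :
    extIntegral μ f = ((∫⁻ x, (f x).toENNReal ∂μ : ENNReal) : EReal) := by
  have : ∀ x, (-f x).toENNReal = 0 := fun x =>
    EReal.toENNReal_of_nonpos (by simpa using h x)
  simp [extIntegral, this]

/-- The triangle inequality for integrals and monotonicity of the lower Lebesgue integral; neither
needs `f` to be measurable. -/
theorem abs_integral_le_extIntegral {d : X → ℝ} {f : X → EReal}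
    (h : ∀ x, ((|d x| : ℝ) : EReal) ≤ f x) : ((|∫ x, d x ∂μ| : ℝ) : EReal) ≤ extIntegral μ f := by
  rw [extIntegral_of_nonneg fun x => le_trans (by exact_mod_cast abs_nonneg _) (h x)]
  have h1 : ((|∫ x, d x ∂μ| : ℝ) : EReal) = ((ENNReal.ofReal |∫ x, d x ∂μ| : ENNReal) : EReal) := by
    rw [EReal.coe_ennreal_ofReal, max_eq_left (abs_nonneg _)]
  rw [h1, EReal.coe_ennreal_le_coe_ennreal_iff, ← Real.norm_eq_abs, ofReal_norm]
  refine (enorm_integral_le_lintegral_enorm _).trans (lintegral_mono fun x => ?_)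
  have h2 := EReal.toENNReal_le_toENNReal (h x)
  rwa [EReal.toENNReal_of_ne_top (by simp), EReal.toReal_coe, ← Real.norm_eq_abs, ofReal_norm]
    at h2

theorem EReal.le_coe_of_forall_pos_le_add {x : EReal} {r : ℝ}
    (h : ∀ ε : ℝ, 0 < ε → x ≤ ((r + ε : ℝ) : EReal)) : x ≤ (r : EReal) := by
  have h1 : Tendsto (fun k : ℕ => r + 1 / ((k : ℝ) + 1)) atTop (𝓝 (r + 0)) :=
    tendsto_one_div_add_atTop_nhds_zero_nat.const_add r
  rw [add_zero] at h1
  exact ge_of_tendsto ((continuous_coe_real_ereal.tendsto r).comp h1)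
    (Eventually.of_forall fun k => h _ (by positivity))

end ExtIntegral

/-! ### Laminates as gradient Young measures -/

section Laminates

variable {N : ℕ}

theorem toEuclideanCLM_vecMulVec (a n : Fin N → ℝ) :
    Matrix.toEuclideanCLM (𝕜 := ℝ) (Matrix.vecMulVec a n)
      = (innerSL ℝ (WithLp.toLp 2 n)).smulRight (WithLp.toLp 2 a) := by
  ext x i
  simp [Matrix.mulVec, dotProduct, Matrix.vecMulVec_apply, PiLp.inner_apply, Finset.sum_mul]
  exact Finset.sum_congr rfl fun k _ => by ring

theorem exists_laminate_sequence (a : Fin N → ℝ) {n : Fin N → ℝ} (hn : n ≠ 0)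
    {Ω : Set (EuclideanSpace ℝ (Fin N))} (hΩ : IsOpen Ω) (hΩc : (Ωᶜ).Nonempty) :
    ∃ (u : ℕ → EuclideanSpace ℝ (Fin N) → EuclideanSpace ℝ (Fin N)) (K : NNReal) (C : ℝ)
      (A B : ℕ → Set (EuclideanSpace ℝ (Fin N))),
      (∀ k, LipschitzWith K (u k)) ∧ (∀ k x, x ∉ Ω → u k x = 0) ∧ (∀ k x, ‖u k x‖ ≤ C) ∧
      (∀ k, MeasurableSet (A k)) ∧ (∀ k, MeasurableSet (B k)) ∧
      (∀ k, A k ⊆ Ω) ∧ (∀ k, B k ⊆ Ω) ∧ (∀ k, Disjoint (A k) (B k)) ∧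
      (∀ k, ∀ x ∈ A k,
        HasFDerivAt (u k) (Matrix.toEuclideanCLM (𝕜 := ℝ) (Matrix.vecMulVec a n)) x) ∧
      (∀ k, ∀ x ∈ B k,
        HasFDerivAt (u k) (Matrix.toEuclideanCLM (𝕜 := ℝ) (-Matrix.vecMulVec a n)) x) ∧
      ∀ g : EuclideanSpace ℝ (Fin N) → ℝ, IntegrableOn g Ω →
        Tendsto (fun k => ∫ x in A k, g x) atTop (𝓝 ((∫ x in Ω, g x) / 2)) ∧
        Tendsto (fun k => ∫ x in B k, g x) atTop (𝓝 ((∫ x in Ω, g x) / 2)) := by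
  have hn' : (WithLp.toLp 2 n : EuclideanSpace ℝ (Fin N)) ≠ 0 := fun h => hn (by
    simpa using congrArg WithLp.ofLp h)
  obtain ⟨w, K, A, B, hK, h0, h1, hA, hB, hAΩ, hBΩ, hAB, hdA, hdB, hlim⟩ :=
    exists_oscillating_sequence (μ := volume) hn' hΩ hΩc
  set a' : EuclideanSpace ℝ (Fin N) := WithLp.toLp 2 a
  -- A scalar oscillation with gradient ±n, multiplied by the fixed vector a, has gradient ±a ⊗ n.
  refine ⟨fun k x => w k x • a', K * ‖a'‖₊, ‖a'‖, A, B, fun k => ?_, fun k x hx => ?_,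
    fun k x => ?_, hA, hB, hAΩ, hBΩ, hAB, fun k x hx => ?_, fun k x hx => ?_, hlim⟩
  · refine LipschitzWith.of_dist_le_mul fun x y => ?_
    rw [dist_eq_norm, ← sub_smul, norm_smul, ← dist_eq_norm, NNReal.coe_mul, coe_nnnorm,
      mul_right_comm]
    exact mul_le_mul_of_nonneg_right ((hK k).dist_le_mul x y) (norm_nonneg _)
  · simp [h0 k x hx]
  · rw [norm_smul]
    exact mul_le_of_le_one_left (norm_nonneg _) (h1 k x)
  · rw [toEuclideanCLM_vecMulVec]
    exact (hdA k x hx).smul_const a'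
  · have h2 : Matrix.toEuclideanCLM (𝕜 := ℝ) (-Matrix.vecMulVec a n)
        = (-innerSL ℝ (WithLp.toLp 2 n)).smulRight a' := by
      rw [map_neg, toEuclideanCLM_vecMulVec]
      ext x i
      simp [a']
    rw [h2]
    exact (hdB k x hx).smul_const a'

theorem setIntegral_eq_add_add_of_disjoint {X : Type*} [MeasurableSpace X] {μ : Measure X}
    {Ω A B : Set X} (hA : MeasurableSet A) (hB : MeasurableSet B) (hAΩ : A ⊆ Ω) (hBΩ : B ⊆ Ω)
    (hAB : Disjoint A B) {h : X → ℝ} (hh : IntegrableOn h Ω μ) :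
    ∫ x in Ω, h x ∂μ = (∫ x in A, h x ∂μ) + (∫ x in B, h x ∂μ) + ∫ x in Ω \ (A ∪ B), h x ∂μ := by
  rw [← setIntegral_union hAB hB (hh.mono_set hAΩ) (hh.mono_set hBΩ),
    ← integral_inter_add_sdiff (hA.union hB) hh,
    Set.inter_eq_right.2 (Set.union_subset hAΩ hBΩ)]

/-- The laminate with two atoms of equal mass at rank-one connected matrices. -/
theorem isHomogeneousGradientYoungMeasure_laminate (F : Matrix (Fin N) (Fin N) ℝ)
    (a : Fin N → ℝ) {n : Fin N → ℝ} (hn : n ≠ 0) {Ω : Set (EuclideanSpace ℝ (Fin N))}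
    (hΩ : IsOpen Ω) (hΩc : (Ωᶜ).Nonempty) (hΩb : Bornology.IsBounded Ω) :
    IsHomogeneousGradientYoungMeasure Ω
      ((1 / 2 : ENNReal) • Measure.dirac (F + Matrix.vecMulVec a n)
        + (1 / 2 : ENNReal) • Measure.dirac (F - Matrix.vecMulVec a n)) := by
  obtain ⟨u, K, C, A, B, hK, h0, hC, hA, hB, hAΩ, hBΩ, hAB, hdA, hdB, hlim⟩ :=
    exists_laminate_sequence a hn hΩ hΩc
  set T := Matrix.toEuclideanCLM (n := Fin N) (𝕜 := ℝ)
  refine ⟨⟨by simp [ENNReal.inv_two_add_inv_two]⟩, fun k x => T F x + u k x, ‖T F‖₊ + K, ?_⟩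
  obtain ⟨M, hM⟩ := hΩb.exists_norm_le
  have hU : ∀ k, LipschitzWith (‖T F‖₊ + K) fun x => T F x + u k x := fun k =>
    (T F).lipschitz.add (hK k)
  refine ⟨‖T F‖ * M + C, fun k => (hU k).lipschitzOnWith, fun k x hx => ?_, fun ψ hψ g hg => ?_⟩
  · refine (norm_add_le _ _).trans (add_le_add (((T F).le_opNorm x).trans ?_) (hC k x))
    exact mul_le_mul_of_nonneg_left (hM x hx) (norm_nonneg _)
  obtain ⟨R, hR0, hR⟩ := hψ.exists_abs_le_of_entries_le (‖T F‖₊ + K : NNReal)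
  have hbd : ∀ k x, |ψ (gradMatrix (fun x => T F x + u k x) x)| ≤ R := fun k x =>
    hR _ (abs_gradMatrix_le (hU k) x)
  have hint : ∀ k, IntegrableOn (fun x => g x * ψ (gradMatrix (fun x => T F x + u k x) x)) Ω :=
    fun k => Integrable.mul_bdd (c := R) hg
      (hψ.measurable.comp (measurable_gradMatrix _)).aestronglyMeasurable
      (Eventually.of_forall fun x => hbd k x)
  have hgA : ∀ k, ∀ x ∈ A k, gradMatrix (fun x => T F x + u k x) x
      = F + Matrix.vecMulVec a n := fun k x hx => by
    apply gradMatrix_eq_of_hasFDerivAt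
    rw [map_add]
    exact (T F).hasFDerivAt.add (hdA k x hx)
  have hgB : ∀ k, ∀ x ∈ B k, gradMatrix (fun x => T F x + u k x) x
      = F - Matrix.vecMulVec a n := fun k x hx => by
    apply gradMatrix_eq_of_hasFDerivAt
    rw [sub_eq_add_neg, map_add]
    exact (T F).hasFDerivAt.add (hdB k x hx)
  have hiA : ∀ k, ∫ x in A k, g x * ψ (gradMatrix (fun x => T F x + u k x) x)
      = (∫ x in A k, g x) * ψ (F + Matrix.vecMulVec a n) := fun k => by
    rw [← integral_mul_const]
    exact setIntegral_congr_fun (hA k) fun x hx => by simp only [hgA k x hx]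
  have hiB : ∀ k, ∫ x in B k, g x * ψ (gradMatrix (fun x => T F x + u k x) x)
      = (∫ x in B k, g x) * ψ (F - Matrix.vecMulVec a n) := fun k => by
    rw [← integral_mul_const]
    exact setIntegral_congr_fun (hB k) fun x hx => by simp only [hgB k x hx]
  -- The two families of layers together carry all of ∫|g| in the limit, and ψ is uniformly bounded
  -- along the gradients.
  have hrest : Tendsto (fun k => ∫ x in Ω \ (A k ∪ B k),
      g x * ψ (gradMatrix (fun x => T F x + u k x) x)) atTop (𝓝 0) := by
    obtain ⟨l1, l2⟩ := hlim (fun x => |g x|) hg.abs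
    have l3 : Tendsto (fun k => ∫ x in Ω \ (A k ∪ B k), |g x|) atTop (𝓝 0) := by
      have l4 := ((l1.add l2).const_sub (∫ x in Ω, |g x|))
      rw [add_halves, sub_self] at l4
      refine l4.congr fun k => ?_
      rw [setIntegral_eq_add_add_of_disjoint (hA k) (hB k) (hAΩ k) (hBΩ k) (hAB k) hg.abs]
      ring
    have l5 := l3.mul_const R
    rw [zero_mul] at l5
    refine squeeze_zero_norm (fun k => ?_) l5
    rw [← integral_mul_const]
    refine (norm_integral_le_integral_norm _).trans ?_
    refine integral_mono ((hint k).mono_set Set.sdiff_subset).norm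
      ((IntegrableOn.mono_set hg.abs Set.sdiff_subset).mul_const R) fun x => ?_
    simp only [norm_mul, Real.norm_eq_abs]
    exact mul_le_mul_of_nonneg_left (hbd k x) (abs_nonneg _)
  obtain ⟨l1, l2⟩ := hlim g hg
  have hfin := ((l1.mul_const (ψ (F + Matrix.vecMulVec a n))).add
    (l2.mul_const (ψ (F - Matrix.vecMulVec a n)))).add hrest
  have hval : ∫ M, ψ M ∂((1 / 2 : ENNReal) • Measure.dirac (F + Matrix.vecMulVec a n)
        + (1 / 2 : ENNReal) • Measure.dirac (F - Matrix.vecMulVec a n))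
      = (ψ (F + Matrix.vecMulVec a n) + ψ (F - Matrix.vecMulVec a n)) / 2 := by
    rw [integral_add_measure, integral_smul_measure, integral_smul_measure, integral_dirac,
      integral_dirac]
    · simp; ring
    · exact (integrable_dirac (by finiteness)).smul_measure (by simp)
    · exact (integrable_dirac (by finiteness)).smul_measure (by simp)
  rw [hval]
  have hgoal : (∫ x in Ω, g x) / 2 * ψ (F + Matrix.vecMulVec a n)
      + (∫ x in Ω, g x) / 2 * ψ (F - Matrix.vecMulVec a n) + 0
      = (∫ x in Ω, g x) * ((ψ (F + Matrix.vecMulVec a n) + ψ (F - Matrix.vecMulVec a n)) / 2) := by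
    ring
  rw [hgoal] at hfin
  refine hfin.congr fun k => ?_
  rw [setIntegral_eq_add_add_of_disjoint (hA k) (hB k) (hAΩ k) (hBΩ k) (hAB k) (hint k), hiA, hiB]

theorem matrixBarycenter_laminate (A B : Matrix (Fin N) (Fin N) ℝ) :
    matrixBarycenter ((1 / 2 : ENNReal) • Measure.dirac (A + B)
      + (1 / 2 : ENNReal) • Measure.dirac (A - B)) = A := by
  ext i j
  simp only [matrixBarycenter, Matrix.of_apply]
  rw [integral_add_measure, integral_smul_measure, integral_smul_measure, integral_dirac,
    integral_dirac]
  · simp; ring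
  · exact (integrable_dirac (by finiteness)).smul_measure (by simp)
  · exact (integrable_dirac (by finiteness)).smul_measure (by simp)

end Laminates

/-! ### The two formulas for the quasiconvexification -/

section Quasiconvexification

variable {N : ℕ} {j : Fin N ⊕ Fin N} {Ω : Set (EuclideanSpace ℝ (Fin N))}
  {φ : Matrix (Fin N) (Fin N) ℝ → EReal}

/-- The index `j` guarantees N ≥ 1; the zero-dimensional space is bounded and would be a
counterexample. -/
theorem nonempty_compl_of_isBounded (j : Fin N ⊕ Fin N) (hb : Bornology.IsBounded Ω) :
    (Ωᶜ).Nonempty := by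
  obtain ⟨i⟩ : Nonempty (Fin N) := ⟨j.elim id id⟩
  have : Nonempty (Fin N) := ⟨i⟩
  have : Nontrivial (EuclideanSpace ℝ (Fin N)) :=
    ⟨EuclideanSpace.single i 1, 0, fun h => by simpa using congrArg (fun x => x i) h⟩
  rw [Set.nonempty_compl]
  rintro rfl
  exact NormedSpace.unbounded_univ ℝ _ hb

theorem quasiconvexification_eq_abs_det (hΩ : IsOpen Ω) (hne : Ω.Nonempty)
    (hb : Bornology.IsBounded Ω)
    (hφ : ∀ F ∈ coincidenceSet j, φ F = ((|F.det| : ℝ) : EReal))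
    (hφ' : ∀ F, ((|F.det| : ℝ) : EReal) ≤ φ F) (F : Matrix (Fin N) (Fin N) ℝ) :
    quasiconvexification Ω φ F = ((|F.det| : ℝ) : EReal) := by
  refine le_antisymm (EReal.le_coe_of_forall_pos_le_add fun ε hε => ?_) (le_sInf ?_)
  · obtain ⟨a, n, hn, m1, m2, hd⟩ := exists_rankOne_split j F hε
    refine le_trans (sInf_le ⟨_, isHomogeneousGradientYoungMeasure_laminate F a hn hΩ
      (nonempty_compl_of_isBounded j hb) hb, matrixBarycenter_laminate _ _, rfl⟩) ?_
    rw [extIntegral_of_nonneg fun A => le_trans (by exact_mod_cast abs_nonneg _) (hφ' A),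
      lintegral_add_measure, lintegral_smul_measure, lintegral_smul_measure, lintegral_dirac,
      lintegral_dirac, hφ _ m1, hφ _ m2, EReal.toENNReal_of_ne_top (by simp),
      EReal.toENNReal_of_ne_top (by simp), EReal.toReal_coe, EReal.toReal_coe]
    have h2 : (1 / 2 : ENNReal) = ENNReal.ofReal (1 / 2) := by
      rw [ENNReal.ofReal_div_of_pos two_pos]; simp
    rw [h2, smul_eq_mul, smul_eq_mul, ← ENNReal.ofReal_mul (by norm_num),
      ← ENNReal.ofReal_mul (by norm_num), ← ENNReal.ofReal_add (by positivity) (by positivity),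
      EReal.coe_ennreal_ofReal, max_eq_left (by positivity)]
    exact_mod_cast by linarith
  · rintro e ⟨ν, hν, rfl, rfl⟩
    rw [← hν.integral_det hΩ hne]
    exact abs_integral_le_extIntegral hφ'

theorem dirichletQuasiconvexification_eq_abs_det (hΩ : IsOpen Ω) (hne : Ω.Nonempty)
    (hb : Bornology.IsBounded Ω)
    (hφ : ∀ F ∈ coincidenceSet j, φ F = ((|F.det| : ℝ) : EReal))
    (hφ' : ∀ F, ((|F.det| : ℝ) : EReal) ≤ φ F)
    (hbd : ∀ R : ℝ, ∃ C : ℝ, ∀ A, (∀ i k, |A i k| ≤ R) → φ A ≤ (C : EReal))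
    (F : Matrix (Fin N) (Fin N) ℝ) :
    dirichletQuasiconvexification Ω φ F = ((|F.det| : ℝ) : EReal) := by
  have hfin : volume Ω ≠ ⊤ := hb.measure_lt_top.ne
  have hpos : 0 < volume.real Ω := ENNReal.toReal_pos (hΩ.measure_pos _ hne).ne' hfin
  refine le_antisymm (EReal.le_coe_of_forall_pos_le_add fun ε hε => ?_) (le_sInf ?_)
  · obtain ⟨a, n, hn, m1, m2, hd⟩ := exists_rankOne_split j F hε
    obtain ⟨u, K, -, A, B, hK, h0, -, hA, hB, hAΩ, hBΩ, hAB, hdA, hdB, hlim⟩ :=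
      exists_laminate_sequence a hn hΩ (nonempty_compl_of_isBounded j hb)
    obtain ⟨R, hR⟩ : ∃ R : ℝ, ∀ i k, |F i k| ≤ R := by
      obtain ⟨R, hR⟩ := Finite.bddAbove_range fun p : Fin N × Fin N => |F p.1 p.2|
      exact ⟨R, fun i k => hR ⟨(i, k), rfl⟩⟩
    obtain ⟨C, hC⟩ := hbd (R + K)
    set d₁ := |(F + Matrix.vecMulVec a n).det|
    set d₂ := |(F - Matrix.vecMulVec a n).det|
    -- Bound for the energy of the k-th competitor: the exact values on the two families of layers,
    -- and the local bound |C| on the remainder, whose volume tends to zero. This is where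
    -- boundedness of φ enters.
    set r : ℕ → ℝ := fun k => (volume.real Ω)⁻¹ * (d₁ * volume.real (A k)
      + d₂ * volume.real (B k)
      + |C| * (volume.real Ω - (volume.real (A k) + volume.real (B k)))) with hr
    have hle : ∀ k, dirichletQuasiconvexification Ω φ F ≤ ((r k : ℝ) : EReal) := by
      intro k
      refine le_trans (sInf_le ⟨u k, ⟨K, hK k⟩, h0 k, rfl⟩) ?_
      rw [extIntegral_of_nonneg fun A => le_trans (by exact_mod_cast abs_nonneg _) (hφ' _),
        lintegral_smul_measure]
      have hAfin : volume (A k) ≠ ⊤ := ((measure_mono (hAΩ k)).trans_lt hfin.lt_top).ne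
      have hBfin : volume (B k) ≠ ⊤ := ((measure_mono (hBΩ k)).trans_lt hfin.lt_top).ne
      have hs : ∀ (S : Set (EuclideanSpace ℝ (Fin N))) (c : ℝ), MeasurableSet S →
          volume S ≠ ⊤ → (∀ x ∈ S, φ (F + gradMatrix (u k) x) ≤ (c : EReal)) →
          ∫⁻ x in S, (φ (F + gradMatrix (u k) x)).toENNReal
            ≤ ENNReal.ofReal (c * volume.real S) := by
        intro S c hS hSfin hle
        refine (setLIntegral_mono' hS fun x hx =>
          EReal.toENNReal_le_toENNReal (hle x hx)).trans ?_
        rw [setLIntegral_const, EReal.toENNReal_of_ne_top (by simp), EReal.toReal_coe,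
          ENNReal.ofReal_mul' measureReal_nonneg, ofReal_measureReal hSfin]
      have hrm : MeasurableSet (Ω \ (A k ∪ B k)) :=
        hΩ.measurableSet.diff ((hA k).union (hB k))
      have hrv : volume.real (Ω \ (A k ∪ B k))
          = volume.real Ω - (volume.real (A k) + volume.real (B k)) := by
        rw [measureReal_sdiff (Set.union_subset (hAΩ k) (hBΩ k)) ((hA k).union (hB k))
          (by finiteness), measureReal_union (hAB k) (hB k) hAfin hBfin]
      have i1 := hs (A k) d₁ (hA k) hAfin fun x hx => by
        rw [gradMatrix_eq_of_hasFDerivAt (hdA k x hx), hφ _ m1]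
      have i2 := hs (B k) d₂ (hB k) hBfin fun x hx => by
        rw [gradMatrix_eq_of_hasFDerivAt (hdB k x hx), ← sub_eq_add_neg, hφ _ m2]
      have i3 := hs (Ω \ (A k ∪ B k)) |C| hrm
        ((measure_mono Set.sdiff_subset).trans_lt hfin.lt_top).ne fun x hx => by
          refine (hC _ fun i l => ?_).trans (by exact_mod_cast le_abs_self C)
          exact (abs_add_le _ _).trans (add_le_add (hR i l) (abs_gradMatrix_le (hK k) x i l))
      have hsplit : Ω = (A k ∪ B k) ∪ (Ω \ (A k ∪ B k)) :=
        (Set.union_sdiff_cancel (Set.union_subset (hAΩ k) (hBΩ k))).symm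
      have i4 : ∫⁻ x in Ω, (φ (F + gradMatrix (u k) x)).toENNReal
          ≤ ENNReal.ofReal (d₁ * volume.real (A k) + d₂ * volume.real (B k)
            + |C| * (volume.real Ω - (volume.real (A k) + volume.real (B k)))) := by
        have hn3 : 0 ≤ |C| * (volume.real Ω - (volume.real (A k) + volume.real (B k))) := by
          rw [← hrv]; positivity
        rw [ENNReal.ofReal_add (by positivity) hn3, ENNReal.ofReal_add (by positivity)
          (by positivity), ← hrv]
        calc _ = ∫⁻ x in (A k ∪ B k) ∪ (Ω \ (A k ∪ B k)),
              (φ (F + gradMatrix (u k) x)).toENNReal := by rw [← hsplit]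
          _ ≤ _ := (lintegral_union_le _ _ _).trans
            (add_le_add ((lintegral_union_le _ _ _).trans (add_le_add i1 i2)) i3)
      have hn4 : 0 ≤ r k := by
        simp only [hr]; rw [← hrv]; positivity
      have i5 : (volume Ω)⁻¹ = ENNReal.ofReal (volume.real Ω)⁻¹ := by
        rw [ENNReal.ofReal_inv_of_pos hpos, ofReal_measureReal hfin]
      have i6 : (volume Ω)⁻¹ * ∫⁻ x in Ω, (φ (F + gradMatrix (u k) x)).toENNReal
          ≤ ENNReal.ofReal (r k) := by
        rw [hr, ENNReal.ofReal_mul (by positivity), ← i5]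
        exact mul_le_mul_right i4 _
      rw [smul_eq_mul]
      refine (EReal.coe_ennreal_le_coe_ennreal_iff.2 i6).trans ?_
      rw [EReal.coe_ennreal_ofReal, max_eq_left hn4]
    have hone : ∀ S : Set (EuclideanSpace ℝ (Fin N)), ∫ _ in S, (1 : ℝ) = volume.real S :=
      fun S => by simp
    obtain ⟨l1, l2⟩ := hlim (fun _ => 1) (integrableOn_const hfin)
    simp only [hone] at l1 l2
    have l3 : Tendsto r atTop (𝓝 ((d₁ + d₂) / 2)) := by
      have l4 := ((((l1.const_mul d₁).add (l2.const_mul d₂)).add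
        (((l1.add l2).const_sub (volume.real Ω)).const_mul |C|))).const_mul (volume.real Ω)⁻¹
      convert! l4 using 2
      field_simp
      ring
    refine (ge_of_tendsto ((continuous_coe_real_ereal.tendsto _).comp l3)
      (Eventually.of_forall hle)).trans ?_
    exact_mod_cast by linarith
  · rintro e ⟨u, ⟨K, hK⟩, h0, rfl⟩
    -- The null Lagrangian property: the average of the determinant is that of the affine boundary
    -- data.
    have h1 : ∫ x, (F + gradMatrix u x).det ∂((volume Ω)⁻¹ • volume.restrict Ω) = F.det := by
      rw [integral_smul_measure, integral_det_add_gradMatrix hK hΩ.measurableSet hfin h0,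
        ENNReal.toReal_inv, smul_eq_mul]
      exact inv_mul_cancel_left₀ hpos.ne' _
    rw [← h1]
    exact abs_integral_le_extIntegral fun x => hφ' _

theorem det_eq_inner_adjLine_matrixLine (j : Fin N ⊕ Fin N) (A : Matrix (Fin N) (Fin N) ℝ) :
    A.det = inner ℝ (adjLine j A) (matrixLine j A) := by
  rcases j with r | c
  · have h := congrFun (congrFun A.mul_adjugate r) r
    simp only [Matrix.mul_apply, Matrix.smul_apply, Matrix.one_apply_eq, smul_eq_mul,
      mul_one] at h
    simp [adjLine, matrixLine, PiLp.inner_apply, ← h]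
  · have h := congrFun (congrFun A.adjugate_mul c) c
    simp only [Matrix.mul_apply, Matrix.smul_apply, Matrix.one_apply_eq, smul_eq_mul,
      mul_one] at h
    simp [adjLine, matrixLine, PiLp.inner_apply, ← h, mul_comm]

theorem continuous_matrixLine (j : Fin N ⊕ Fin N) :
    Continuous (matrixLine j : Matrix (Fin N) (Fin N) ℝ → EuclideanSpace ℝ (Fin N)) := by
  rcases j with r | c
  · exact (PiLp.continuous_toLp 2 _).comp
      (by fun_prop : Continuous fun A : Matrix (Fin N) (Fin N) ℝ => fun k => A r k)
  · exact (PiLp.continuous_toLp 2 _).comp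
      (by fun_prop : Continuous fun A : Matrix (Fin N) (Fin N) ℝ => fun k => A k c)

theorem continuous_adjLine (j : Fin N ⊕ Fin N) :
    Continuous (adjLine j : Matrix (Fin N) (Fin N) ℝ → EuclideanSpace ℝ (Fin N)) :=
  (continuous_matrixLine j).comp
    (by fun_prop : Continuous fun A : Matrix (Fin N) (Fin N) ℝ => A.adjugate.transpose)

theorem abs_det_le_norm_adjLine_mul_norm (j : Fin N ⊕ Fin N) (A : Matrix (Fin N) (Fin N) ℝ) :
    |A.det| ≤ ‖adjLine j A‖ * ‖matrixLine j A‖ := by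
  rw [det_eq_inner_adjLine_matrixLine j]
  exact abs_real_inner_le_norm _ _

theorem norm_adjLine_mul_norm_of_mem {A : Matrix (Fin N) (Fin N) ℝ} (hA : A ∈ coincidenceSet j) :
    ‖adjLine j A‖ * ‖matrixLine j A‖ = |A.det| := by
  obtain ⟨α, hα⟩ := hA
  rw [det_eq_inner_adjLine_matrixLine j, ← hα, real_inner_smul_left, real_inner_self_eq_norm_sq,
    norm_smul, abs_mul, abs_pow, abs_norm, Real.norm_eq_abs]
  ring

end Quasiconvexification

/-! ### The theorem, for general φ and for the product of norms -/

theorem theorem1p2 {N : ℕ} (j : Fin N ⊕ Fin N)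
    (Ω : Set (EuclideanSpace ℝ (Fin N))) (hΩ_open : IsOpen Ω) (hΩ_ne : Ω.Nonempty)
    (hΩ_bdd : Bornology.IsBounded Ω) :
    (∀ φ : Matrix (Fin N) (Fin N) ℝ → EReal,
      (∀ F ∈ coincidenceSet j, φ F = ((|F.det| : ℝ) : EReal)) →
      (∀ F ∉ coincidenceSet j, ((|F.det| : ℝ) : EReal) ≤ φ F) →
      (∀ F, quasiconvexification Ω φ F = ((|F.det| : ℝ) : EReal)) ∧
      ((∀ R : ℝ, ∃ C : ℝ, ∀ A, (∀ i k, |A i k| ≤ R) → φ A ≤ (C : EReal)) →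
        ∀ F, dirichletQuasiconvexification Ω φ F = ((|F.det| : ℝ) : EReal))) ∧
    (∀ F, quasiconvexification Ω
        (fun A : Matrix (Fin N) (Fin N) ℝ => ((‖adjLine j A‖ * ‖matrixLine j A‖ : ℝ) : EReal)) F
      = ((|F.det| : ℝ) : EReal)) ∧
    (∀ F, dirichletQuasiconvexification Ω
        (fun A : Matrix (Fin N) (Fin N) ℝ => ((‖adjLine j A‖ * ‖matrixLine j A‖ : ℝ) : EReal)) F
      = ((|F.det| : ℝ) : EReal)) := by
  have hmem : ∀ F ∈ coincidenceSet j,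
      ((‖adjLine j F‖ * ‖matrixLine j F‖ : ℝ) : EReal) = ((|F.det| : ℝ) : EReal) :=
    fun F hF => congrArg _ (norm_adjLine_mul_norm_of_mem hF)
  have hle : ∀ F, ((|F.det| : ℝ) : EReal) ≤ ((‖adjLine j F‖ * ‖matrixLine j F‖ : ℝ) : EReal) :=
    fun F => EReal.coe_le_coe_iff.2 (abs_det_le_norm_adjLine_mul_norm j F)
  have hbd : ∀ R : ℝ, ∃ C : ℝ, ∀ A : Matrix (Fin N) (Fin N) ℝ, (∀ i k, |A i k| ≤ R) →
      ((‖adjLine j A‖ * ‖matrixLine j A‖ : ℝ) : EReal) ≤ (C : EReal) := by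
    intro R
    obtain ⟨C, -, hC⟩ := Continuous.exists_abs_le_of_entries_le
      ((continuous_adjLine j).norm.mul (continuous_matrixLine j).norm) R
    exact ⟨C, fun A hA => EReal.coe_le_coe_iff.2 ((le_abs_self _).trans (hC A hA))⟩
  refine ⟨fun φ hφ hφ' => ?_,
    quasiconvexification_eq_abs_det hΩ_open hΩ_ne hΩ_bdd hmem hle,
    dirichletQuasiconvexification_eq_abs_det hΩ_open hΩ_ne hΩ_bdd hmem hle hbd⟩
  have hall : ∀ F, ((|F.det| : ℝ) : EReal) ≤ φ F := fun F => by
    by_cases h : F ∈ coincidenceSet j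
    · exact (hφ F h).ge
    · exact hφ' F h
  exact ⟨quasiconvexification_eq_abs_det hΩ_open hΩ_ne hΩ_bdd hφ hall,
    dirichletQuasiconvexification_eq_abs_det hΩ_open hΩ_ne hΩ_bdd hφ hall⟩
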